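/- Let $K$ be a field. **Gelfand–Kirillov dimension.** For $f:\mathbb N\to\mathbb N\cup\{\infty\}$ put $\gamma(f)=\inf\{r\ge 0 : f(i)\le i^r \text{ for } i\gg 0\}\in[0,\infty]$. For a finite dimensional subspace $V$ of a $K$-algebra $A$ put $A_i=(K+V)^i$; if $V$ generates $A$, then $F=\{A_i\}$ is a *standard filtration* of $A$. Let $\mathrm{GK}(A)=\sup_V\gamma(i\mapsto\dim_K (K+V)^i)$, over all finite dimensional subspaces $V\subseteq A$; if $A$ is finitely generated, this equals $\gamma(i\mapsto\dim_K A_i)$ for every standard filtration $\{A_i\}$. **Filter dimensions.** Let $R$ be a finitely generated $K$-algebra with standard filtration $F=\{R_i\}$, and let $M$ be an $R$-module generated by a finite dimensional subspace $M_0$. Let $\nu_{F,M_0}(i)$ be the least $j\in\mathbb N\cup\{\infty\}$ such that $R_jN\supseteq M_0$ for every subspace $N\subseteq R_iM_0$ with $RN=M$. The number $\gamma(\nu_{F,M_0})$ does not depend on $F$ and $M_0$; it is the *filter dimension* of $M$. The filter dimension $\mathrm{fd}_K(A)$ of a finitely generated $K$-algebra $A$ is that of $A$ as a left $A\otimes_K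 A^{\mathrm{op}}$-module. If $A$ is finitely generated and simple with standard filtration $F=\{A_i\}$, let $\lambda_F(i)$ be the least $j\in\mathbb N\cup\{\infty\}$ such that $1\in AaA_j$ for all $0\ne a\in A_i$; the *left filter dimension* is $\mathrm{lfd}_K(A)=\gamma(\lambda_F)$, which does not depend on $F$. For $\mathrm d\in\{\mathrm{fd},\mathrm{lfd}\}$ let $$f_A=\max\{\mathrm d_{Q_m}(Q_m\otimes_K A) : m\in\mathbb N,\ 0\le m\le \mathrm{GK}(A)\},$$ where $Q_0=K$ and $Q_m=K(x_1,\dots,x_m)$ is the field of rational functions, and the filter dimension is taken over the field $Q_m$. **Poisson algebras.** Let $P$ be a commutative Poisson $K$-algebra with bracket $\{\cdot,\cdot\}$, write $\mathrm{ad}(a)=\{a,\cdot\}$, and let $A(P)\subseteq \mathrm{End}_K(P)$ be the subalgebra generated by the multiplications by elements of $P$ and by all $\mathrm{ad}(a)$, $a\in P$. Call $P$ *strongly simple* if 1. $P$ is a finitely generated commutative $K$-algebra and a domain; 2. $A(P)$ is a central simple $K$-algebra (simple with centre $K$, not necessarily finite dimensional); 3. whenever $a_1,\dots,a_m\in P$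 are algebraically independent over $K$ and $\{a_i,a_j\}=0$ for all $i,j$, the commuting elements $a_1,\dots,a_m,\mathrm{ad}(a_1),\dots,\mathrm{ad}(a_m)$ of $A(P)$ are algebraically independent over $K$. **Theorem.** Let $P$ be a strongly simple Poisson algebra over $K$ and let $C$ be an isotropic subalgebra of $P$, i.e. a (unital, associative) $K$-subalgebra with $\{C,C\}=0$. Then, both for $\mathrm d=\mathrm{fd}$ and for $\mathrm d=\mathrm{lfd}$, $$\mathrm{GK}(C)\le\frac{\mathrm{GK}(A(P))}{2}\left(1-\frac{1}{f_{A(P)}+\max\{f_{A(P)},1\}}\right),$$ where $1/\infty=0$. -/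

import Mathlib

open scoped ENNReal NNReal TensorProduct

universe u v w

noncomputable section

/-! ### Degree of growth, standard filtrations, Gelfand-Kirillov dimension -/

/-- The degree `γ(f) = inf {r ≥ 0 | f(i) ≤ i ^ r for i ≫ 0}`, an element of `[0, ∞]`, of a function
`f : ℕ → ℕ ∪ {∞}`. -/
def growthDegree (f : ℕ → ℕ∞) : ℝ≥0∞ :=
  ⨅ (r : ℝ≥0) (_ : ∀ᶠ i : ℕ in Filter.atTop, ((f i : ℕ∞) : ℝ≥0∞) ≤ (i : ℝ≥0∞) ^ (r : ℝ)),
    (r : ℝ≥0∞)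

/-- The standard filtration `A_0 = K`, `A_1 = K + V`, `A_i = A_1 ^ i` attached to a subspace `V`
(the span of the chosen algebra generators) of a `K`-algebra `A`. -/
def stdFiltration (K : Type u) {A : Type v} [Field K] [Ring A] [Algebra K A]
    (V : Submodule K A) (i : ℕ) : Submodule K A :=
  (1 ⊔ V) ^ i

/-- `V` is a finite dimensional subspace that generates `A` as a `K`-algebra. -/
def IsAlgGenerating (K : Type u) {A : Type v} [Field K] [Ring A] [Algebra K A]
    (V : Submodule K A) : Prop :=
  FiniteDimensional K V ∧ Algebra.adjoin K (V : Set A) = ⊤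

/-- The Gelfand-Kirillov dimension over `K` of a `K`-algebra: the supremum, over all finite
dimensional subspaces `V`, of the degree of `i ↦ dim (K + V) ^ i`. For a finitely generated algebra
every generating `V` attains the supremum. -/
def gkDim (K : Type u) (A : Type v) [Field K] [Ring A] [Algebra K A] : ℝ≥0∞ :=
  ⨆ (V : Submodule K A) (_ : FiniteDimensional K V),
    growthDegree fun i => (Module.finrank K (stdFiltration K V i) : ℕ∞)

/-! ### Return functions and filter dimensions -/

/-- The product `S N` of a subspace `S` of an algebra `R` and a subspace `N` of an `R`-module:
the `K`-span of all `r • n`. -/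
def actSpan (K : Type u) {R : Type v} {M : Type w} [Field K] [Ring R] [Algebra K R]
    [AddCommGroup M] [Module K M] [Module R M]
    (S : Submodule K R) (N : Submodule K M) : Submodule K M :=
  Submodule.span K {x | ∃ r ∈ S, ∃ n ∈ N, x = r • n}

/-- `M₀` is a finite dimensional subspace that generates `M` as an `R`-module. -/
def IsModGenerating (K : Type u) (R : Type v) {M : Type w} [Field K] [Ring R] [Algebra K R]
    [AddCommGroup M] [Module K M] [Module R M] (M₀ : Submodule K M) : Prop :=
  FiniteDimensional K M₀ ∧ Submodule.span R (M₀ : Set M) = ⊤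

/-- The return function `ν_{F,M₀}` of the `R`-module `M`: here `F = {R_i}` is the standard
filtration given by `V`, and `ν_{F,M₀}(i)` is the least `j ∈ ℕ ∪ {∞}` such that `R_j N ⊇ M₀`
for every subspace `N` of `M_i = R_i M₀` that generates the module `M`. -/
def returnFunction (K : Type u) {R : Type v} {M : Type w} [Field K] [Ring R] [Algebra K R]
    [AddCommGroup M] [Module K M] [Module R M]
    (V : Submodule K R) (M₀ : Submodule K M) (i : ℕ) : ℕ∞ :=
  ⨅ (j : ℕ) (_ : ∀ N : Submodule K M, N ≤ actSpan K (stdFiltration K V i) M₀ →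
      Submodule.span R (N : Set M) = ⊤ → M₀ ≤ actSpan K (stdFiltration K V j) N), (j : ℕ∞)

/-- The filter dimension of a finitely generated module over a finitely generated algebra: the
degree of its return function. The degree is the same for all choices of `V` and `M₀`; the infimum
over all choices is this common value. -/
def moduleFilterDim (K : Type u) (R : Type v) (M : Type w) [Field K] [Ring R] [Algebra K R]
    [AddCommGroup M] [Module K M] [Module R M] : ℝ≥0∞ :=
  ⨅ (V : Submodule K R) (_ : IsAlgGenerating K V) (M₀ : Submodule K M)
    (_ : IsModGenerating K R M₀), growthDegree (returnFunction K V M₀)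

/-- The filter dimension `fd(A)` of a finitely generated algebra: the filter dimension of `A` as a
left module over `A ⊗ Aᵒᵖ`, where `(a ⊗ b) x = a x b`. -/
def filterDim (K : Type u) (A : Type v) [Field K] [Ring A] [Algebra K A] : ℝ≥0∞ :=
  letI : Module (A ⊗[K] Aᵐᵒᵖ) A := TensorProduct.Algebra.module
  moduleFilterDim K (A ⊗[K] Aᵐᵒᵖ) A

/-- The left return function `λ_F` of a (simple) algebra `A`: `λ_F(i)` is the least `j ∈ ℕ ∪ {∞}`
such that, for every `0 ≠ a ∈ A_i`, the left ideal `A a A_j` generated by `a A_j` contains `1`. -/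
def leftReturnFunction (K : Type u) {A : Type v} [Field K] [Ring A] [Algebra K A]
    (V : Submodule K A) (i : ℕ) : ℕ∞ :=
  ⨅ (j : ℕ) (_ : ∀ a ∈ stdFiltration K V i, a ≠ 0 →
      (1 : A) ∈ Submodule.span A {x : A | ∃ y ∈ stdFiltration K V j, x = a * y}), (j : ℕ∞)

/-- The left filter dimension `lfd(A)` of a simple finitely generated algebra: the degree of its
left return function. The degree is the same for all generating subspaces `V`; the infimum is this
common value. -/
def leftFilterDim (K : Type u) (A : Type v) [Field K] [Ring A] [Algebra K A] : ℝ≥0∞ :=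
  ⨅ (V : Submodule K A) (_ : IsAlgGenerating K V), growthDegree (leftReturnFunction K V)

/-- The rational function field `Q_m = K(x_1, …, x_m)`, with `Q_0 = K`. -/
abbrev RatFunField (K : Type u) [Field K] (m : ℕ) : Type u :=
  FractionRing (MvPolynomial (Fin m) K)

/-- `f_A = max {fd_{Q_m}(Q_m ⊗ A) | 0 ≤ m ≤ GK(A)}`. -/
def maxFilterDim (K : Type u) (A : Type v) [Field K] [Ring A] [Algebra K A] : ℝ≥0∞ :=
  ⨆ (m : ℕ) (_ : (m : ℝ≥0∞) ≤ gkDim K A), filterDim (RatFunField K m) (RatFunField K m ⊗[K] A)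

/-- `f_A = max {lfd_{Q_m}(Q_m ⊗ A) | 0 ≤ m ≤ GK(A)}`, the version for the left filter dimension. -/
def maxLeftFilterDim (K : Type u) (A : Type v) [Field K] [Ring A] [Algebra K A] : ℝ≥0∞ :=
  ⨆ (m : ℕ) (_ : (m : ℝ≥0∞) ≤ gkDim K A),
    leftFilterDim (RatFunField K m) (RatFunField K m ⊗[K] A)

/-! ### Poisson algebras -/

/-- A Poisson algebra structure on a commutative `K`-algebra `P`: a `K`-bilinear Lie bracket that
satisfies the Leibniz rule. -/
class PoissonAlgebra (K : Type u) (P : Type v) [Field K] [CommRing P] [Algebra K P] where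
  bracket : P →ₗ[K] P →ₗ[K] P
  bracket_self : ∀ a, bracket a a = 0
  jacobi : ∀ a b c,
    bracket a (bracket b c) + bracket b (bracket c a) + bracket c (bracket a b) = 0
  leibniz : ∀ a x y, bracket a (x * y) = bracket a x * y + x * bracket a y

namespace PoissonAlgebra

variable (K : Type u) (P : Type v) [Field K] [CommRing P] [Algebra K P] [PoissonAlgebra K P]

/-- The algebra `A(P)`: the subalgebra of `End_K(P)` (in fact, of the differential operators on `P`)
generated by the multiplications by elements of `P` and the inner derivations
`ad a = {a, ·}`, `a ∈ P`. -/
def opAlgebra : Subalgebra K (Module.End K P) :=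
  Algebra.adjoin K
    (Set.range (fun a : P => LinearMap.mulLeft K a) ∪ Set.range (fun a : P => bracket (K := K) a))

variable {P}

/-- Multiplication by `a`, as an element of `A(P)`. -/
def mulOp (a : P) : opAlgebra K P :=
  ⟨LinearMap.mulLeft K a, Algebra.subset_adjoin (Or.inl ⟨a, rfl⟩)⟩

/-- The inner derivation `ad a`, as an element of `A(P)`. -/
def adOp (a : P) : opAlgebra K P :=
  ⟨bracket (K := K) a, Algebra.subset_adjoin (Or.inr ⟨a, rfl⟩)⟩

end PoissonAlgebra

/-- A family `x` of elements of a (not necessarily commutative) `K`-algebra `A` consists of commuting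
algebraically independent elements: `X_i ↦ x_i` defines an embedding of the polynomial algebra
into `A`. -/
def CommAlgIndependent (K : Type u) {A : Type v} {ι : Type w} [Field K] [Ring A] [Algebra K A]
    (x : ι → A) : Prop :=
  ∃ φ : MvPolynomial ι K →ₐ[K] A, Function.Injective φ ∧ ∀ i, φ (MvPolynomial.X i) = x i

/-- Strongly simple Poisson algebras. -/
structure IsStronglySimplePoisson (K : Type u) (P : Type v) [Field K] [CommRing P] [Algebra K P]
    [PoissonAlgebra K P] : Prop where
  finiteType : Algebra.FiniteType K P
  isDomain : IsDomain P
  isCentral : Algebra.IsCentral K (PoissonAlgebra.opAlgebra K P)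
  isSimple : IsSimpleRing (PoissonAlgebra.opAlgebra K P)
  independent : ∀ (m : ℕ) (a : Fin m → P), AlgebraicIndependent K a →
    (∀ i j, PoissonAlgebra.bracket (K := K) (a i) (a j) = 0) →
    CommAlgIndependent K (Sum.elim (fun i => PoissonAlgebra.mulOp K (a i))
      (fun i => PoissonAlgebra.adOp K (a i)) : Fin m ⊕ Fin m → PoissonAlgebra.opAlgebra K P)

/-- A subalgebra `C` of a Poisson algebra is isotropic if `{C, C} = 0`. -/
def IsIsotropic (K : Type u) {P : Type v} [Field K] [CommRing P] [Algebra K P] [PoissonAlgebra K P]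
    (C : Subalgebra K P) : Prop :=
  ∀ a ∈ C, ∀ b ∈ C, PoissonAlgebra.bracket (K := K) a b = 0

end

/-! The core is an inequality for an algebra `A` that contains a polynomial algebra `T` in `n`
variables. Let `L` be the fraction field of `T`, identified with `Q_n`. Right multiplication by `T`
commutes with left multiplication by `A`, so `L ⊗[K] A` acts on `L ⊗[T] A`. Elements of `A_i`
independent over `T` stay independent over `K` after multiplication by distinct monomials, and there
are about `i ^ n` monomials of degree `O(i)`. Hence the orbit `A_i (1 ⊗ 1)` has `L`-dimension `O(i ^
(r - n))` for each `r > GK(A)` (`exists_bound_of_polynomialSubalgebra`).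

The left filter dimension bounds growth from the other side. If `1` lies in `S a X_j` for every
nonzero `a` in `X_i`, then no such `a` kills `X_j v`, so `dim X_i ≤ dim (X_j v) * dim (X_{i+j} v)`
(`finrank_stdFiltration_le_mul`). With `j ≤ i ^ s` this yields `GK(A) ≤ (r - n) (s + max s 1)`
(`gkDim_le_of_representation`, `bounds_of_polynomialSubalgebra`). Letting `r` and `s` decrease to
`GK(A)` and `f`, and solving for `n`, gives `n ≤ GK(A) (1 - 1 / (f + max f 1))`.

By Noether normalization `GK(C)` is at most the largest number `s` of variables of a polynomial
subalgebra of `C`. Since `C` is isotropic, strong simplicity turns these `s` elements into `n = 2 s`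
commuting independent elements of `A(P)`, which explains the factor `1 / 2`. Solving for `n`
requires `GK(A(P))` to be finite. For finite `f` this follows from the same filter inequality
applied to the action of `A(P)` on `P` (`gkDim_opAlgebra_ne_top`). The bound for `fd` follows from
the one for `lfd`, because `lfd ≤ fd` (`leftFilterDim_le_filterDim`) and the bound increases with
`f`. -/

open Filter Topology

/-! ### Degrees of growth. -/

lemma eventually_le_of_growthDegree_lt {f : ℕ → ℕ∞} {r : ℝ≥0} (h : growthDegree f < r) :
    ∀ᶠ i : ℕ in atTop, ((f i : ℕ∞) : ℝ≥0∞) ≤ (i : ℝ≥0∞) ^ (r : ℝ) := by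
  simp only [growthDegree, iInf_lt_iff] at h
  obtain ⟨q, hq, hqr⟩ := h
  have hqr' : (q : ℝ) ≤ r := by exact_mod_cast (ENNReal.coe_lt_coe.mp hqr).le
  filter_upwards [hq, eventually_ge_atTop 1] with i hi h1
  exact hi.trans (ENNReal.rpow_le_rpow_of_exponent_le (by exact_mod_cast h1) hqr')

/-- A constant factor and the shift to `i + 1` cost nothing: `i ^ ε` eventually exceeds `C * 2 ^ r`
for every `ε > 0`. -/
lemma growthDegree_le_of_eventually_le {f : ℕ → ℕ∞} {r C : ℝ≥0}
    (h : ∀ᶠ i : ℕ in atTop,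
      ((f i : ℕ∞) : ℝ≥0∞) ≤ ((C * ((i : ℝ≥0) + 1) ^ (r : ℝ) : ℝ≥0) : ℝ≥0∞)) :
    growthDegree f ≤ r := by
  refine ENNReal.le_of_forall_pos_le_add fun ε hε _ => ?_
  rw [← ENNReal.coe_add]
  refine iInf₂_le (r + ε) ?_
  have ht : Tendsto (fun i : ℕ => ((i : ℝ≥0)) ^ (ε : ℝ)) atTop atTop :=
    (NNReal.tendsto_rpow_atTop (by exact_mod_cast hε)).comp tendsto_natCast_atTop_atTop
  filter_upwards [h, ht.eventually_ge_atTop (C * 2 ^ (r : ℝ)), eventually_ge_atTop 1]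
    with i hi hC h1
  refine hi.trans ?_
  have h1' : (1 : ℝ≥0) ≤ i := by exact_mod_cast h1
  have hi0 : (i : ℝ≥0) ≠ 0 := (lt_of_lt_of_le one_pos h1').ne'
  rw [← ENNReal.coe_natCast, ← ENNReal.coe_rpow_of_nonneg _ (by positivity), ENNReal.coe_le_coe]
  calc C * ((i : ℝ≥0) + 1) ^ (r : ℝ) ≤ C * (2 * (i : ℝ≥0)) ^ (r : ℝ) := by
        gcongr
        rw [two_mul]
        gcongr
    _ = (C * 2 ^ (r : ℝ)) * (i : ℝ≥0) ^ (r : ℝ) := by rw [NNReal.mul_rpow, mul_assoc]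
    _ ≤ (i : ℝ≥0) ^ (ε : ℝ) * (i : ℝ≥0) ^ (r : ℝ) := by gcongr
    _ = (i : ℝ≥0) ^ ((r + ε : ℝ≥0) : ℝ) := by
        rw [NNReal.coe_add, NNReal.rpow_add hi0, mul_comm]

lemma growthDegree_natCast_le {d : ℕ → ℕ} {r C : ℝ≥0}
    (h : ∀ᶠ i : ℕ in atTop, (d i : ℝ≥0) ≤ C * ((i : ℝ≥0) + 1) ^ (r : ℝ)) :
    growthDegree (fun i => (d i : ℕ∞)) ≤ r := by
  refine growthDegree_le_of_eventually_le (C := C) ?_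
  filter_upwards [h] with i hi
  rw [ENat.toENNReal_coe, ← ENNReal.coe_natCast]
  exact ENNReal.coe_le_coe.mpr hi

/-- For finite values, the finitely many exceptional `i` are absorbed into the constant. -/
lemma exists_bound_of_growthDegree_natCast_lt {d : ℕ → ℕ} {r : ℝ≥0}
    (h : growthDegree (fun i => (d i : ℕ∞)) < r) :
    ∃ C : ℝ≥0, ∀ i : ℕ, (d i : ℝ≥0) ≤ C * ((i : ℝ≥0) + 1) ^ (r : ℝ) := by
  obtain ⟨N, hN⟩ := eventually_atTop.mp (eventually_le_of_growthDegree_lt h)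
  refine ⟨1 + ∑ k ∈ Finset.range N, (d k : ℝ≥0), fun i => ?_⟩
  have h1 : (1 : ℝ≥0) ≤ ((i : ℝ≥0) + 1) ^ (r : ℝ) :=
    NNReal.one_le_rpow le_add_self r.coe_nonneg
  rcases lt_or_ge i N with hi | hi
  · calc (d i : ℝ≥0) ≤ ∑ k ∈ Finset.range N, (d k : ℝ≥0) :=
          Finset.single_le_sum (f := fun k => (d k : ℝ≥0)) (fun _ _ => zero_le)
            (Finset.mem_range.mpr hi)
      _ ≤ (1 + ∑ k ∈ Finset.range N, (d k : ℝ≥0)) * 1 := by simp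
      _ ≤ _ := by gcongr
  · have := hN i hi
    rw [ENat.toENNReal_coe, ← ENNReal.coe_natCast, ← ENNReal.coe_natCast,
      ← ENNReal.coe_rpow_of_nonneg _ r.coe_nonneg, ENNReal.coe_le_coe] at this
    calc (d i : ℝ≥0) ≤ (i : ℝ≥0) ^ (r : ℝ) := this
      _ ≤ 1 * ((i : ℝ≥0) + 1) ^ (r : ℝ) := by
          rw [one_mul]; gcongr; exact le_self_add
      _ ≤ _ := by gcongr; exact le_self_add

/-- Affine changes of the argument and of the value do not raise the degree of growth. -/
lemma growthDegree_le_of_le_comp {f g : ℕ → ℕ∞} {c e : ℕ} (hc : 1 ≤ c)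
    (h : ∀ i, f i ≤ g (c * i + e) + e) : growthDegree f ≤ growthDegree g := by
  refine le_of_forall_gt fun b hb => ?_
  obtain ⟨r, hr, hrb⟩ := ENNReal.lt_iff_exists_nnreal_btwn.mp hb
  refine lt_of_le_of_lt ?_ hrb
  refine growthDegree_le_of_eventually_le (C := ((c + e : ℕ) : ℝ≥0) ^ (r : ℝ) + e) ?_
  -- Here `1 ≤ c` is needed: the bound on `g` is only eventual, so its argument must tend to
  -- infinity.
  have ht : Tendsto (fun i : ℕ => c * i + e) atTop atTop :=
    tendsto_atTop_mono (fun i => show i ≤ c * i + e by nlinarith) tendsto_id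
  filter_upwards [ht.eventually (eventually_le_of_growthDegree_lt hr)] with i hi
  have h2 : ((f i : ℕ∞) : ℝ≥0∞) ≤ ((g (c * i + e) : ℕ∞) : ℝ≥0∞) + (e : ℝ≥0∞) := by
    have := ENat.toENNReal_le.mpr (h i)
    simpa using this
  refine h2.trans ((add_le_add_left hi _).trans ?_)
  rw [← ENNReal.coe_natCast, ← ENNReal.coe_natCast, ← ENNReal.coe_rpow_of_nonneg _ r.coe_nonneg,
    ← ENNReal.coe_add, ENNReal.coe_le_coe, add_mul, ← NNReal.mul_rpow]
  have h1 : (1 : ℝ≥0) ≤ ((i : ℝ≥0) + 1) ^ (r : ℝ) := NNReal.one_le_rpow le_add_self r.coe_nonneg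
  gcongr
  · have : c * i + e ≤ (c + e) * (i + 1) := by nlinarith
    exact_mod_cast this
  · exact le_mul_of_one_le_right zero_le h1

/-! ### Standard filtrations. -/

section StdFiltration

variable {K : Type*} {A : Type*} {B : Type*} [Field K] [Ring A] [Algebra K A] [Ring B] [Algebra K B]

lemma one_mem_stdFiltration (V : Submodule K A) (i : ℕ) : (1 : A) ∈ stdFiltration K V i := by
  have := Submodule.pow_mem_pow (1 ⊔ V) (Submodule.mem_sup_left (Submodule.one_le.mp le_rfl)) i
  rwa [one_pow] at this

lemma stdFiltration_mul (V : Submodule K A) (i j : ℕ) :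
    stdFiltration K V i * stdFiltration K V j = stdFiltration K V (i + j) :=
  (pow_add _ _ _).symm

lemma mul_mem_stdFiltration {V : Submodule K A} {i j : ℕ} {a b : A}
    (ha : a ∈ stdFiltration K V i) (hb : b ∈ stdFiltration K V j) :
    a * b ∈ stdFiltration K V (i + j) :=
  stdFiltration_mul V i j ▸ Submodule.mul_mem_mul ha hb

lemma stdFiltration_mono (V : Submodule K A) : Monotone (stdFiltration K V) :=
  pow_right_monotone (le_sup_left : (1 : Submodule K A) ≤ 1 ⊔ V)

lemma stdFiltration_mono_left {V W : Submodule K A} (h : V ≤ W) (i : ℕ) :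
    stdFiltration K V i ≤ stdFiltration K W i :=
  pow_le_pow_left' (sup_le_sup_left h 1) i

lemma le_stdFiltration_one (V : Submodule K A) : V ≤ stdFiltration K V 1 := by
  rw [stdFiltration, pow_one]; exact le_sup_right

lemma stdFiltration_zero (V : Submodule K A) : stdFiltration K V 0 = 1 := pow_zero _

lemma stdFiltration_succ (V : Submodule K A) (i : ℕ) :
    stdFiltration K V (i + 1) = stdFiltration K V i * (1 ⊔ V) := pow_succ _ _

lemma stdFiltration_le_of_le {V W : Submodule K A} {c : ℕ} (h : V ≤ stdFiltration K W c) (i : ℕ) :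
    stdFiltration K V i ≤ stdFiltration K W (c * i) := by
  have h1 : (1 : Submodule K A) ⊔ V ≤ stdFiltration K W c :=
    sup_le (Submodule.one_le.mpr (one_mem_stdFiltration W c)) h
  calc stdFiltration K V i ≤ stdFiltration K W c ^ i := pow_le_pow_left' h1 i
    _ = stdFiltration K W (c * i) := (pow_mul _ _ _).symm

lemma map_stdFiltration (f : A →ₐ[K] B) (V : Submodule K A) (i : ℕ) :
    (stdFiltration K V i).map f.toLinearMap = stdFiltration K (V.map f.toLinearMap) i := by
  rw [stdFiltration, Submodule.map_pow, Submodule.map_sup, Submodule.map_one]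
  rfl

instance finiteDimensional_stdFiltration (V : Submodule K A) [FiniteDimensional K V] (i : ℕ) :
    FiniteDimensional K (stdFiltration K V i) := by
  have h1 : (1 ⊔ V : Submodule K A).FG :=
    Submodule.FG.sup ⟨{1}, by rw [Finset.coe_singleton, Submodule.one_eq_span]⟩
      (Submodule.fg_iff_finiteDimensional V |>.mpr inferInstance)
  exact (Submodule.fg_iff_finiteDimensional _).mp (h1.pow i)

lemma Submodule.FG.exists_le_of_monotone {M : Type*} [AddCommGroup M] [Module K M]
    {F : ℕ → Submodule K M} (hF : Monotone F) {W : Submodule K M} (hW : W.FG)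
    (h : ∀ x ∈ W, ∃ i, x ∈ F i) : ∃ c, W ≤ F c := by
  obtain ⟨s, rfl⟩ := hW
  choose! e he using h
  refine ⟨s.sup e, Submodule.span_le.mpr fun x hx => ?_⟩
  exact hF (Finset.le_sup hx) (he x (Submodule.subset_span hx))

lemma stdFiltration_le_adjoin (V : Submodule K A) (i : ℕ) :
    stdFiltration K V i ≤ (Algebra.adjoin K (V : Set A)).toSubmodule := by
  induction i with
  | zero => rw [stdFiltration_zero]; exact Submodule.one_le.mpr (one_mem (Algebra.adjoin K _))
  | succ i ih =>
    rw [stdFiltration_succ, Submodule.mul_le]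
    intro x hx y hy
    have h1 : 1 ⊔ V ≤ (Algebra.adjoin K (V : Set A)).toSubmodule :=
      sup_le (Submodule.one_le.mpr (one_mem (Algebra.adjoin K _))) Algebra.subset_adjoin
    exact Subalgebra.mul_mem _ (ih hx) (h1 hy)

lemma exists_mem_stdFiltration {V : Submodule K A} (hV : Algebra.adjoin K (V : Set A) = ⊤) (x : A) :
    ∃ i, x ∈ stdFiltration K V i := by
  have hx : x ∈ Algebra.adjoin K (V : Set A) := hV ▸ Algebra.mem_top
  induction hx using Algebra.adjoin_induction with
  | mem x hx => exact ⟨1, le_stdFiltration_one V hx⟩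
  | algebraMap r =>
    exact ⟨0, by rw [stdFiltration_zero]; exact Submodule.algebraMap_mem r⟩
  | add x y _ _ hx hy =>
    obtain ⟨i, hi⟩ := hx
    obtain ⟨j, hj⟩ := hy
    exact ⟨max i j, add_mem (stdFiltration_mono V (le_max_left i j) hi)
      (stdFiltration_mono V (le_max_right i j) hj)⟩
  | mul x y _ _ hx hy =>
    obtain ⟨i, hi⟩ := hx
    obtain ⟨j, hj⟩ := hy
    exact ⟨i + j, mul_mem_stdFiltration hi hj⟩

lemma exists_le_stdFiltration {V : Submodule K A} (hV : Algebra.adjoin K (V : Set A) = ⊤)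
    (W : Submodule K A) [FiniteDimensional K W] : ∃ c, W ≤ stdFiltration K V c :=
  ((Submodule.fg_iff_finiteDimensional W).mpr inferInstance).exists_le_of_monotone
    (stdFiltration_mono V) fun x _ => exists_mem_stdFiltration hV x

end StdFiltration

/-! ### Bimodule generation in simple algebras and in their scalar extensions. -/

section Simple

variable {K : Type*} {A : Type*} [Field K] [Ring A] [Algebra K A]

/-- A nonzero element of a simple ring generates the ring as a bimodule. -/
lemma IsSimpleRing.one_mem_of_mul_mem [IsSimpleRing A] (N : AddSubgroup A)
    (hl : ∀ x, ∀ y ∈ N, x * y ∈ N) (hr : ∀ x, ∀ y ∈ N, y * x ∈ N) {a : A} (ha : a ∈ N)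
    (ha0 : a ≠ 0) : (1 : A) ∈ N := by
  let I : TwoSidedIdeal A := TwoSidedIdeal.mk' N N.zero_mem N.add_mem N.neg_mem
    (fun {x y} h => hl x y h) (fun {x y} h => hr y x h)
  have hI : ∀ x, x ∈ I ↔ x ∈ N := fun x => by
    simp [I, TwoSidedIdeal.mem_mk']
  rcases eq_bot_or_eq_top I with h | h
  · exact absurd ((TwoSidedIdeal.mem_bot A).mp (h ▸ (hI a).mpr ha)) ha0
  · exact (hI 1).mp (h ▸ trivial)

/-- If `A` is central simple over `K`, a nonzero element of `L ⊗ A` generates it as a bimodule. -/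
lemma TensorProduct.one_mem_of_mul_mem (L : Type*) [Field L] [Algebra K L]
    [Algebra.IsCentral K A] [IsSimpleRing A] (N : AddSubgroup (L ⊗[K] A))
    (hl : ∀ x, ∀ y ∈ N, x * y ∈ N) (hr : ∀ x, ∀ y ∈ N, y * x ∈ N) {w₀ : L ⊗[K] A}
    (hw₀ : w₀ ∈ N) (hw₀0 : w₀ ≠ 0) : (1 : L ⊗[K] A) ∈ N := by
  classical
  let b := Module.Basis.ofVectorSpace K L
  let e : L ⊗[K] A ≃ₗ[K] _ →₀ A := TensorProduct.equivFinsuppOfBasisLeft b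
  have eleft : ∀ (x : A) (w : L ⊗[K] A) i, e ((1 ⊗ₜ x) * w) i = x * e w i := by
    intro x w i
    induction w with
    | zero => simp
    | tmul l y => simp [e]
    | add w w' h h' => simp only [mul_add, map_add, Finsupp.add_apply, h, h']
  have eright : ∀ (x : A) (w : L ⊗[K] A) i, e (w * (1 ⊗ₜ x)) i = e w i * x := by
    intro x w i
    induction w with
    | zero => simp
    | tmul l y => simp [e]
    | add w w' h h' => simp only [add_mul, map_add, Finsupp.add_apply, h, h']
  -- a nonzero element of minimal support
  obtain ⟨w, ⟨hwN, hw0⟩, hmin⟩ := (measure fun w : L ⊗[K] A => (e w).support.card).wf.has_min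
    {w | w ∈ N ∧ w ≠ 0} ⟨w₀, hw₀, hw₀0⟩
  have hew : e w ≠ 0 := by simpa using hw0
  obtain ⟨i₀, hi₀⟩ := Finsupp.ne_iff.mp hew
  -- the coefficients at `i₀` of the elements of `N` supported in the support of `w`
  let J : AddSubgroup A :=
    { carrier := {x | ∃ y ∈ N, (e y).support ⊆ (e w).support ∧ e y i₀ = x}
      zero_mem' := ⟨0, N.zero_mem, by simp, by simp⟩
      add_mem' := by
        rintro _ _ ⟨y, hy, hys, rfl⟩ ⟨z, hz, hzs, rfl⟩
        refine ⟨y + z, N.add_mem hy hz, ?_, by simp⟩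
        rw [map_add]
        exact Finsupp.support_add.trans (Finset.union_subset hys hzs)
      neg_mem' := by
        rintro _ ⟨y, hy, hys, rfl⟩
        exact ⟨-y, N.neg_mem hy, by rwa [map_neg, Finsupp.support_neg], by simp⟩ }
  have hJ : (1 : A) ∈ J := by
    refine IsSimpleRing.one_mem_of_mul_mem J ?_ ?_ (a := e w i₀) ⟨w, hwN, le_rfl, rfl⟩ hi₀
    · rintro x _ ⟨y, hy, hys, rfl⟩
      refine ⟨(1 ⊗ₜ x) * y, hl _ _ hy, fun i hi => hys ?_, eleft x y i₀⟩
      rw [Finsupp.mem_support_iff, eleft] at hi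
      exact Finsupp.mem_support_iff.mpr (right_ne_zero_of_mul hi)
    · rintro x _ ⟨y, hy, hys, rfl⟩
      refine ⟨y * (1 ⊗ₜ x), hr _ _ hy, fun i hi => hys ?_, eright x y i₀⟩
      rw [Finsupp.mem_support_iff, eright] at hi
      exact Finsupp.mem_support_iff.mpr (left_ne_zero_of_mul hi)
  obtain ⟨y, hyN, hys, hy1⟩ := hJ
  -- all coefficients of `y` are central
  have hcomm : ∀ x : A, (1 ⊗ₜ x) * y - y * (1 ⊗ₜ x) = 0 := by
    intro x
    -- The coefficient of `y` at `i₀` is `1`, so the commutator vanishes there and has smaller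
    -- support than `w`. Minimality forces it to be zero.
    by_contra hne
    refine hmin _ ⟨N.sub_mem (hl _ _ hyN) (hr _ _ hyN), hne⟩ ?_
    refine Finset.card_lt_card ⟨fun i hi => hys ?_, fun hsub => ?_⟩
    · rw [Finsupp.mem_support_iff, map_sub, Finsupp.sub_apply, eleft, eright] at hi
      rw [Finsupp.mem_support_iff]
      rintro h0
      simp [h0] at hi
    · have := hsub (Finsupp.mem_support_iff.mpr hi₀)
      rw [Finsupp.mem_support_iff, map_sub, Finsupp.sub_apply, eleft, eright, hy1] at this
      simp at this
  have hcentral : ∀ i, ∃ k : K, algebraMap K A k = e y i := by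
    intro i
    have : e y i ∈ Subalgebra.center K A := by
      rw [Subalgebra.mem_center_iff]
      intro x
      have := congrArg (fun z => e z i) (hcomm x)
      simpa [eleft, eright, sub_eq_zero] using this
    exact Algebra.IsCentral.out this
  choose k hk using hcentral
  have hy : ∃ l : L, y = l ⊗ₜ 1 := by
    have hsum : y = (e y).sum fun i n => b i ⊗ₜ[K] n :=
      (e.symm_apply_apply y).symm.trans (TensorProduct.equivFinsuppOfBasisLeft_symm_apply b _)
    refine ⟨(e y).sum fun i _ => k i • b i, hsum.trans ?_⟩
    rw [Finsupp.sum, Finsupp.sum, TensorProduct.sum_tmul]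
    refine Finset.sum_congr rfl fun i _ => ?_
    rw [← hk, Algebra.algebraMap_eq_smul_one, TensorProduct.tmul_smul, TensorProduct.smul_tmul']
  obtain ⟨l, rfl⟩ := hy
  have hl0 : l ≠ 0 := by
    rintro rfl
    simp at hy1
  have := hl (l⁻¹ ⊗ₜ 1) _ hyN
  rwa [Algebra.TensorProduct.tmul_mul_tmul, inv_mul_cancel₀ hl0, one_mul] at this

end Simple

/-! ### Products of subspaces of an algebra and of a module. -/

section ActSpan

variable {K : Type*} {R : Type*} {M : Type*} [Field K] [Ring R] [Algebra K R]
  [AddCommGroup M] [Module K M] [Module R M]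

lemma smul_mem_actSpan {S : Submodule K R} {N : Submodule K M} {r : R} {n : M} (hr : r ∈ S)
    (hn : n ∈ N) : r • n ∈ actSpan K S N :=
  Submodule.subset_span ⟨r, hr, n, hn, rfl⟩

lemma actSpan_le {S : Submodule K R} {N X : Submodule K M} (h : ∀ r ∈ S, ∀ n ∈ N, r • n ∈ X) :
    actSpan K S N ≤ X := by
  refine Submodule.span_le.mpr ?_
  rintro _ ⟨r, hr, n, hn, rfl⟩
  exact h r hr n hn

lemma actSpan_mono {S S' : Submodule K R} {N N' : Submodule K M} (h : S ≤ S') (h' : N ≤ N') :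
    actSpan K S N ≤ actSpan K S' N' :=
  actSpan_le fun _ hr _ hn => smul_mem_actSpan (h hr) (h' hn)

variable [IsScalarTower K R M]

lemma smul_mem_actSpan_mul {S T : Submodule K R} {N : Submodule K M} {r : R} (hr : r ∈ S) {x : M}
    (hx : x ∈ actSpan K T N) : r • x ∈ actSpan K (S * T) N := by
  have : SMulCommClass K R M := IsScalarTower.to_smulCommClass
  induction hx using Submodule.span_induction with
  | mem x hx =>
    obtain ⟨t, ht, n, hn, rfl⟩ := hx
    rw [smul_smul]
    exact smul_mem_actSpan (Submodule.mul_mem_mul hr ht) hn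
  | zero => rw [smul_zero]; exact zero_mem _
  | add x y _ _ hx hy => rw [smul_add]; exact add_mem hx hy
  | smul k x _ hx => rw [smul_comm]; exact Submodule.smul_mem _ _ hx

lemma actSpan_actSpan_le {S T : Submodule K R} {N : Submodule K M} :
    actSpan K S (actSpan K T N) ≤ actSpan K (S * T) N :=
  actSpan_le fun _ hr _ hx => smul_mem_actSpan_mul hr hx

lemma exists_mem_actSpan {V : Submodule K R} (hV : Algebra.adjoin K (V : Set R) = ⊤)
    {M₀ : Submodule K M} {x : M} (hx : x ∈ Submodule.span R (M₀ : Set M)) :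
    ∃ e, x ∈ actSpan K (stdFiltration K V e) M₀ := by
  induction hx using Submodule.span_induction with
  | mem x hx =>
    refine ⟨0, ?_⟩
    rw [← one_smul R x]
    exact smul_mem_actSpan (one_mem_stdFiltration V 0) hx
  | zero => exact ⟨0, zero_mem _⟩
  | add x y _ _ hx hy =>
    obtain ⟨i, hi⟩ := hx
    obtain ⟨j, hj⟩ := hy
    exact ⟨max i j, add_mem (actSpan_mono (stdFiltration_mono V (le_max_left i j)) le_rfl hi)
      (actSpan_mono (stdFiltration_mono V (le_max_right i j)) le_rfl hj)⟩
  | smul r x _ hx =>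
    obtain ⟨i, hi⟩ := hx
    obtain ⟨j, hj⟩ := exists_mem_stdFiltration hV r
    exact ⟨j + i, stdFiltration_mul V j i ▸ smul_mem_actSpan_mul hj hi⟩

end ActSpan

/-! ### Comparison of the left filter dimension with the filter dimension. -/

section FilterDim

variable {K : Type u} {A : Type v} [Field K] [Ring A] [Algebra K A]

attribute [local instance] TensorProduct.Algebra.module

lemma TensorProduct.isScalarTower_mulOpposite : IsScalarTower K (A ⊗[K] Aᵐᵒᵖ) A where
  smul_assoc k r x := by
    change TensorProduct.Algebra.moduleAux (k • r) x = k • TensorProduct.Algebra.moduleAux r x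
    rw [map_smul, LinearMap.smul_apply]

attribute [local instance] TensorProduct.isScalarTower_mulOpposite

lemma tmul_op_smul (a b x : A) : (a ⊗ₜ[K] MulOpposite.op b) • x = a * x * b := by
  rw [TensorProduct.Algebra.smul_def, MulOpposite.smul_eq_mul_unop, MulOpposite.unop_op,
    smul_eq_mul, mul_assoc]

/-- The action of a subspace spanned by tensors `a ⊗ b` with `a, b ∈ W` is controlled by `W`. -/
lemma smul_mem_stdFiltration_mul_mul {V : Submodule K (A ⊗[K] Aᵐᵒᵖ)} {W : Submodule K A}
    (hVW : ∀ v ∈ V, ∀ x : A, v • x ∈ (1 ⊔ W) * Submodule.span K {x} * (1 ⊔ W)) (i : ℕ)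
    {r : A ⊗[K] Aᵐᵒᵖ} (hr : r ∈ stdFiltration K V i) (x : A) :
    r • x ∈ stdFiltration K W i * Submodule.span K {x} * stdFiltration K W i := by
  induction i generalizing r with
  | zero =>
    rw [stdFiltration_zero] at hr ⊢
    obtain ⟨k, rfl⟩ := Submodule.mem_one.mp hr
    rw [algebraMap_smul, one_mul, mul_one]
    exact Submodule.smul_mem _ _ (Submodule.mem_span_singleton_self x)
  | succ i ih =>
    have h1 : (1 : Submodule K A) ≤ 1 ⊔ W := le_sup_left
    have key : ∀ v ∈ (1 ⊔ V : Submodule K _), ∀ x : A,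
        v • x ∈ (1 ⊔ W) * Submodule.span K {x} * (1 ⊔ W) := by
      intro v hv x
      obtain ⟨y, hy, z, hz, rfl⟩ := Submodule.mem_sup.mp hv
      obtain ⟨k, rfl⟩ := Submodule.mem_one.mp hy
      rw [add_smul]
      refine add_mem ?_ (hVW z hz x)
      rw [algebraMap_smul]
      have : Submodule.span K {x} ≤ (1 ⊔ W) * Submodule.span K {x} * (1 ⊔ W) := by
        calc Submodule.span K {x} = 1 * Submodule.span K {x} * 1 := by rw [one_mul, mul_one]
          _ ≤ _ := mul_le_mul' (mul_le_mul' h1 le_rfl) h1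
      exact this (Submodule.smul_mem _ _ (Submodule.mem_span_singleton_self x))
    rw [stdFiltration, pow_succ', ← stdFiltration] at hr
    induction hr using Submodule.mul_induction_on' with
    | mem_mul_mem v hv s hs =>
      rw [mul_smul]
      refine (?_ : (1 ⊔ W) * Submodule.span K {s • x} * (1 ⊔ W) ≤ _) (key v hv (s • x))
      have h2 : Submodule.span K {s • x} ≤ _ :=
        (Submodule.span_singleton_le_iff_mem _ _).mpr (ih hs)
      calc (1 ⊔ W) * Submodule.span K {s • x} * (1 ⊔ W)
          ≤ (1 ⊔ W) * (stdFiltration K W i * Submodule.span K {x} * stdFiltration K W i) *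
            (1 ⊔ W) := mul_le_mul' (mul_le_mul' le_rfl h2) le_rfl
        _ = ((1 ⊔ W) * stdFiltration K W i) * Submodule.span K {x} *
            (stdFiltration K W i * (1 ⊔ W)) := by simp only [mul_assoc]
        _ = _ := by rw [stdFiltration, ← pow_succ, ← pow_succ', ← stdFiltration]
    | add y _ z _ hy hz => rw [add_smul]; exact add_mem hy hz

/-- Finitely many tensors involve only finitely many left and right factors; `W` is spanned by both
kinds. -/
lemma exists_control_of_finiteDimensional (V : Submodule K (A ⊗[K] Aᵐᵒᵖ)) [FiniteDimensional K V] :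
    ∃ W : Submodule K A, FiniteDimensional K W ∧
      ∀ v ∈ V, ∀ x : A, v • x ∈ W * Submodule.span K {x} * W := by
  obtain ⟨s, hs⟩ := (Submodule.fg_iff_finiteDimensional V).mpr inferInstance
  obtain ⟨M', N', hM, hN, hsub⟩ :=
    TensorProduct.exists_finite_submodule_of_setFinite (s : Set (A ⊗[K] Aᵐᵒᵖ)) s.finite_toSet
  let N'' : Submodule K A := N'.map (MulOpposite.opLinearEquiv K).symm.toLinearMap
  refine ⟨M' ⊔ N'', inferInstance, fun v hv x => ?_⟩
  have hv' : v ∈ LinearMap.range (TensorProduct.mapIncl M' N') := by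
    rw [← hs] at hv
    exact Submodule.span_le.mpr hsub hv
  obtain ⟨t, rfl⟩ := hv'
  clear hv
  induction t with
  | zero => rw [map_zero]; exact (zero_smul (A ⊗[K] Aᵐᵒᵖ) x).symm ▸ zero_mem _
  | tmul a b =>
    have : (TensorProduct.mapIncl M' N') (a ⊗ₜ b) • x = a.1 * x * b.1.unop := by
      rw [← tmul_op_smul (K := K)]; rfl
    rw [this]
    refine Submodule.mul_mem_mul (Submodule.mul_mem_mul (Submodule.mem_sup_left a.2)
      (Submodule.mem_span_singleton_self x)) (Submodule.mem_sup_right ⟨b.1, b.2, rfl⟩)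
  | add y z hy hz =>
    rw [map_add, add_smul]
    exact add_mem hy hz

/-- The left filter dimension of a simple algebra does not exceed the filter dimension. -/
theorem leftFilterDim_le_filterDim
    (hA : ∀ N : AddSubgroup A, (∀ x, ∀ y ∈ N, x * y ∈ N) → (∀ x, ∀ y ∈ N, y * x ∈ N) →
      ∀ a ∈ N, a ≠ 0 → (1 : A) ∈ N) :
    leftFilterDim K A ≤ filterDim K A := by
  refine le_iInf fun V => le_iInf fun hV => le_iInf fun M₀ => le_iInf fun hM₀ => ?_
  have := hV.1
  have := hM₀.1
  obtain ⟨W₀, hW₀, hVW₀⟩ := exists_control_of_finiteDimensional V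
  -- `W₀` controls the action of `V`. Adding `M₀` lets generation be read off from the fact that
  -- `M₀` generates the bimodule `A`.
  let W := W₀ ⊔ M₀
  have hW₀W : W₀ ≤ 1 ⊔ W := le_sup_left.trans le_sup_right
  have hact := fun i {r} => smul_mem_stdFiltration_mul_mul (V := V) (W := W) (fun v hv x =>
    mul_le_mul' (mul_le_mul' hW₀W le_rfl) hW₀W (hVW₀ v hv x)) i (r := r)
  -- `W` generates `A`
  have hWgen : Algebra.adjoin K (W : Set A) = ⊤ := by
    refine Algebra.eq_top_iff.mpr fun x => ?_
    have hx : x ∈ Submodule.span (A ⊗[K] Aᵐᵒᵖ) (M₀ : Set A) := hM₀.2 ▸ Submodule.mem_top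
    induction hx using Submodule.span_induction with
    | mem x hx => exact Algebra.subset_adjoin (Submodule.mem_sup_right hx)
    | zero => exact zero_mem _
    | add x y _ _ hx hy => exact add_mem hx hy
    | smul r x _ hx =>
      obtain ⟨i, hi⟩ := exists_mem_stdFiltration hV.2 r
      have h1 := hact i hi x
      refine (?_ : _ ≤ (Algebra.adjoin K (W : Set A)).toSubmodule) h1
      rw [Submodule.mul_le]
      intro y hy z hz
      refine Subalgebra.mul_mem _ ?_ (stdFiltration_le_adjoin W i hz)
      refine (?_ : _ ≤ (Algebra.adjoin K (W : Set A)).toSubmodule) hy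
      rw [Submodule.mul_le]
      intro y hy z hz
      refine Subalgebra.mul_mem _ (stdFiltration_le_adjoin W i hy) ?_
      obtain ⟨k, rfl⟩ := Submodule.mem_span_singleton.mp hz
      exact Subalgebra.smul_mem _ hx k
  refine iInf₂_le_of_le W ⟨inferInstance, hWgen⟩ ?_
  obtain ⟨c, hc⟩ := exists_le_stdFiltration hV.2
    (W.map (Algebra.TensorProduct.includeLeft : A →ₐ[K] A ⊗[K] Aᵐᵒᵖ).toLinearMap)
  obtain ⟨e, he⟩ := exists_mem_actSpan hV.2 (M₀ := M₀) (x := (1 : A)) (hM₀.2 ▸ Submodule.mem_top)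
  -- An element `a` of `W_i` lies in degree `(c + 1) * i + e` of the filtration of the bimodule: `c
  -- * i` for the factor `a ⊗ 1` and `e` to reach `1` from `M₀`. A return `j` from `K a` to `M₀`
  -- becomes a return `j + e` to `1`. The slope is `c + 1` because it has to be positive.
  refine growthDegree_le_of_le_comp (c := c + 1) (e := e) (by lia) fun i => ?_
  rw [← tsub_le_iff_right]
  refine le_iInf₂ fun j hj => ?_
  rw [tsub_le_iff_right]
  rw [← Nat.cast_add]
  refine iInf₂_le _ fun a ha ha0 => ?_
  have haN : Submodule.span K {a} ≤ actSpan K (stdFiltration K V ((c + 1) * i + e)) M₀ := by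
    rw [Submodule.span_singleton_le_iff_mem]
    have h1 : a ⊗ₜ[K] (1 : Aᵐᵒᵖ) ∈ stdFiltration K V ((c + 1) * i) := by
      refine stdFiltration_mono V (by gcongr; lia) (stdFiltration_le_of_le hc i ?_)
      rw [← map_stdFiltration]
      exact ⟨a, ha, rfl⟩
    have h2 := smul_mem_actSpan_mul h1 he
    rw [stdFiltration_mul] at h2
    have h3 : (a ⊗ₜ[K] (1 : Aᵐᵒᵖ)) • (1 : A) = a := by
      rw [← MulOpposite.op_one, tmul_op_smul, mul_one, mul_one]
    rwa [h3] at h2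
  have hgen :
      Submodule.span (A ⊗[K] Aᵐᵒᵖ) ((Submodule.span K {a} : Submodule K A) : Set A) = ⊤ := by
    set N := Submodule.span (A ⊗[K] Aᵐᵒᵖ) ((Submodule.span K {a} : Submodule K A) : Set A)
    have hl : ∀ x, ∀ y ∈ N, x * y ∈ N := fun x y hy => by
      have := N.smul_mem (x ⊗ₜ[K] MulOpposite.op 1) hy
      rwa [tmul_op_smul, mul_one] at this
    have hr : ∀ x, ∀ y ∈ N, y * x ∈ N := fun x y hy => by
      have := N.smul_mem (1 ⊗ₜ[K] MulOpposite.op x) hy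
      rwa [tmul_op_smul, one_mul] at this
    have h1 := hA N.toAddSubgroup hl hr a
      (Submodule.subset_span (Submodule.mem_span_singleton_self a)) ha0
    refine (Submodule.eq_top_iff').mpr fun x => ?_
    rw [← mul_one x]
    exact hl x 1 h1
  have h1 : (1 : A) ∈ actSpan K (stdFiltration K V (j + e)) (Submodule.span K {a}) := by
    have := actSpan_actSpan_le (actSpan_mono le_rfl (hj _ haN hgen) he)
    rwa [stdFiltration_mul, add_comm] at this
  have h2 : (1 : A) ∈ stdFiltration K W (j + e) * Submodule.span K {a} *
      stdFiltration K W (j + e) := by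
    refine actSpan_le (fun r hr n hn => ?_) h1
    have h3 : Submodule.span K {n} ≤ Submodule.span K {a} :=
      (Submodule.span_singleton_le_iff_mem _ _).mpr hn
    exact (mul_le_mul' (mul_le_mul' le_rfl h3) le_rfl : _ ≤ _) (hact _ hr n)
  refine (?_ : _ ≤ (Submodule.span A {x : A | ∃ y ∈ stdFiltration K W (j + e),
    x = a * y}).restrictScalars K) h2
  have h4 : Submodule.span K {a} * stdFiltration K W (j + e) ≤
      (Submodule.span A {x : A | ∃ y ∈ stdFiltration K W (j + e),
        x = a * y}).restrictScalars K := by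
    rw [Submodule.mul_le]
    intro z hz y hy
    obtain ⟨k, rfl⟩ := Submodule.mem_span_singleton.mp hz
    rw [smul_mul_assoc]
    exact Submodule.smul_mem _ k (Submodule.subset_span ⟨y, hy, rfl⟩)
  rw [mul_assoc, Submodule.mul_le]
  exact fun p _ q hq => Submodule.smul_mem _ p (h4 hq)

end FilterDim

/-! ### Extension of scalars and standard filtrations. -/

section BaseChange

variable {K : Type*} {A : Type*} (L : Type*) [Field K] [Ring A] [Algebra K A] [Field L] [Algebra K L]

lemma Submodule.finrank_baseChange {M : Type*} [AddCommGroup M] [Module K M] (U : Submodule K M) :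
    Module.finrank L (U.baseChange L) = Module.finrank K U := by
  have hinj : Function.Injective (U.subtype.baseChange L) :=
    Module.Flat.lTensor_preserves_injective_linearMap U.subtype U.injective_subtype
  exact (LinearEquiv.ofInjective _ hinj).finrank_eq.symm.trans Module.finrank_baseChange

open Pointwise in
lemma Submodule.baseChange_mul_eq (U U' : Submodule K A) :
    (U * U').baseChange L = U.baseChange L * U'.baseChange L := by
  have h : ∀ U : Submodule K A, U.baseChange L = Submodule.span L
      (U.map (Algebra.TensorProduct.includeRight : A →ₐ[K] L ⊗[K] A).toLinearMap :
        Set (L ⊗[K] A)) := fun U => U.baseChange_eq_span L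
  rw [h, h, h, Submodule.map_mul, Submodule.span_mul_span, ← Submodule.span_span_of_tower K L (_ * _ : Set _),
    ← Submodule.span_mul_span, Submodule.span_eq, Submodule.span_eq]

lemma Submodule.baseChange_sup_eq {M : Type*} [AddCommGroup M] [Module K M] (U U' : Submodule K M) :
    (U ⊔ U').baseChange L = U.baseChange L ⊔ U'.baseChange L := by
  rw [← Submodule.span_eq U, ← Submodule.span_eq U', ← Submodule.span_union,
    Submodule.baseChange_span, Submodule.baseChange_span, Submodule.baseChange_span,
    Set.image_union, Submodule.span_union]

lemma Submodule.baseChange_one_eq :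
    (1 : Submodule K A).baseChange L = (1 : Submodule L (L ⊗[K] A)) := by
  rw [Submodule.one_eq_span, Submodule.baseChange_span, Submodule.one_eq_span]
  simp [Algebra.TensorProduct.one_def]

lemma baseChange_stdFiltration (V : Submodule K A) (i : ℕ) :
    (stdFiltration K V i).baseChange L = stdFiltration L (V.baseChange L) i := by
  induction i with
  | zero => rw [stdFiltration_zero, stdFiltration_zero, Submodule.baseChange_one_eq]
  | succ i ih =>
    rw [stdFiltration_succ, stdFiltration_succ, Submodule.baseChange_mul_eq, ih,
      Submodule.baseChange_sup_eq, Submodule.baseChange_one_eq]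

instance Submodule.finiteDimensional_baseChange {M : Type*} [AddCommGroup M] [Module K M]
    (U : Submodule K M) [FiniteDimensional K U] : FiniteDimensional L (U.baseChange L) :=
  Module.Finite.of_surjective _ (U.subtype.baseChange L).surjective_rangeRestrict

/-- Finitely many tensors involve finitely many vectors of `M`. This bounds a filtration of `L ⊗ A`
by one extended from `A`. -/
lemma Submodule.exists_le_baseChange {M : Type*} [AddCommGroup M] [Module K M]
    (W : Submodule L (L ⊗[K] M)) [FiniteDimensional L W] :
    ∃ V : Submodule K M, FiniteDimensional K V ∧ W ≤ V.baseChange L := by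
  obtain ⟨s, hs⟩ := (Submodule.fg_iff_finiteDimensional W).mpr inferInstance
  obtain ⟨V, hV, hsub⟩ :=
    TensorProduct.exists_finite_submodule_right_of_setFinite (s : Set (L ⊗[K] M)) s.finite_toSet
  refine ⟨V, hV, ?_⟩
  rw [← hs, Submodule.span_le]
  exact hsub

end BaseChange

/-! ### The filter inequality. -/

section FilterInequality

/-- The left return function is attained where it is finite. -/
lemma exists_eq_leftReturnFunction {K : Type*} {A : Type*} [Field K] [Ring A] [Algebra K A]
    {V : Submodule K A} {i : ℕ} (h : leftReturnFunction K V i ≠ ⊤) :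
    ∃ j : ℕ, leftReturnFunction K V i = j ∧ ∀ a ∈ stdFiltration K V i, a ≠ 0 →
      (1 : A) ∈ Submodule.span A {x : A | ∃ y ∈ stdFiltration K V j, x = a * y} := by
  classical
  have hex : ∃ j : ℕ, ∀ a ∈ stdFiltration K V i, a ≠ 0 →
      (1 : A) ∈ Submodule.span A {x : A | ∃ y ∈ stdFiltration K V j, x = a * y} := by
    by_contra hne
    push Not at hne
    refine h (iInf₂_eq_top.mpr fun j hj => ?_)
    obtain ⟨a, ha, ha0, h1⟩ := hne j
    exact absurd (hj a ha ha0) h1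
  refine ⟨Nat.find hex, le_antisymm (iInf₂_le _ (Nat.find_spec hex))
    (le_iInf₂ fun j hj => ?_), Nat.find_spec hex⟩
  exact_mod_cast Nat.find_min' hex hj

variable {L : Type*} {S : Type*} {D : Type*} [Field L] [Ring S] [Algebra L S] [AddCommGroup D]
  [Module L D]

/-- The subspace `X v` of a representation. -/
noncomputable def orbitSpan (τ : S →ₐ[L] Module.End L D) (v : D) (X : Submodule L S) : Submodule L D :=
  X.map (LinearMap.applyₗ v ∘ₗ τ.toLinearMap)

lemma mem_orbitSpan {τ : S →ₐ[L] Module.End L D} {v : D} {X : Submodule L S} {x : S} (hx : x ∈ X) :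
    τ x v ∈ orbitSpan τ v X :=
  ⟨x, hx, rfl⟩

instance finiteDimensional_orbitSpan (τ : S →ₐ[L] Module.End L D) (v : D) (X : Submodule L S)
    [FiniteDimensional L X] : FiniteDimensional L (orbitSpan τ v X) :=
  inferInstanceAs (FiniteDimensional L (X.map (LinearMap.applyₗ v ∘ₗ τ.toLinearMap)))

/-- If `1 ∈ S a X_j` for all nonzero `a ∈ X_i`, then `X_i` embeds into `Hom(X_j v, X_{i+j} v)`. -/
lemma finrank_stdFiltration_le_mul (τ : S →ₐ[L] Module.End L D) {v : D} (hv : v ≠ 0)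
    (W : Submodule L S) [FiniteDimensional L W] {i j : ℕ}
    (h : ∀ a ∈ stdFiltration L W i, a ≠ 0 →
      (1 : S) ∈ Submodule.span S {x : S | ∃ y ∈ stdFiltration L W j, x = a * y}) :
    Module.finrank L (stdFiltration L W i) ≤
      Module.finrank L (orbitSpan τ v (stdFiltration L W j)) *
      Module.finrank L (orbitSpan τ v (stdFiltration L W (i + j))) := by
  have hmem : ∀ x ∈ stdFiltration L W i, ∀ m ∈ orbitSpan τ v (stdFiltration L W j),
      τ x m ∈ orbitSpan τ v (stdFiltration L W (i + j)) := by
    rintro x hx _ ⟨y, hy, rfl⟩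
    refine ⟨x * y, mul_mem_stdFiltration hx hy, ?_⟩
    simp
  let Ψ : stdFiltration L W i →ₗ[L] (orbitSpan τ v (stdFiltration L W j) →ₗ[L]
      orbitSpan τ v (stdFiltration L W (i + j))) :=
    LinearMap.mk₂ L (fun x m => ⟨τ x.1 m.1, hmem x.1 x.2 m.1 m.2⟩)
      (fun _ _ _ => by ext; simp) (fun _ _ _ => by ext; simp)
      (fun _ _ _ => by ext; simp) (fun _ _ _ => by ext; simp)
  have hΨ : Function.Injective Ψ := by
    rw [injective_iff_map_eq_zero]
    rintro ⟨a, ha⟩ h0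
    by_contra hne
    have ha0 : a ≠ 0 := fun h => hne (by simp [h])
    have h1 := h a ha ha0
    -- If `a` kills `X_j v`, then the annihilator of `v`, a left ideal, contains `a X_j` and
    -- therefore `1`.
    have hkill : ∀ x ∈ Submodule.span S {x : S | ∃ y ∈ stdFiltration L W j, x = a * y},
        τ x v = 0 := by
      intro x hx
      induction hx using Submodule.span_induction with
      | mem x hx =>
        obtain ⟨y, hy, rfl⟩ := hx
        have := congrArg Subtype.val (LinearMap.congr_fun h0 ⟨τ y v, mem_orbitSpan hy⟩)
        simpa [Ψ] using this
      | zero => simp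
      | add x y _ _ hx hy => simp [hx, hy]
      | smul r x _ hx => simp [hx]
    exact hv (by simpa using hkill 1 h1)
  exact (LinearMap.finrank_le_finrank_of_injective hΨ).trans_eq (Module.finrank_linearMap ..)

variable {K : Type*} {A : Type*} [Field K] [Ring A] [Algebra K A] [Algebra K L]

/-- The filter inequality for the left filter dimension. -/
theorem gkDim_le_of_representation (τ : L ⊗[K] A →ₐ[L] Module.End L D) {v : D} (hv : v ≠ 0)
    {t s : ℝ≥0}
    (hdim : ∀ V : Submodule K A, FiniteDimensional K V → ∃ C : ℝ≥0, ∀ i : ℕ,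
      (Module.finrank L (orbitSpan τ v ((stdFiltration K V i).baseChange L)) : ℝ≥0) ≤
        C * ((i : ℝ≥0) + 1) ^ (t : ℝ))
    (hs : leftFilterDim L (L ⊗[K] A) < s) :
    gkDim K A ≤ ((t * (s + max s 1) : ℝ≥0) : ℝ≥0∞) := by
  simp only [leftFilterDim, iInf_lt_iff] at hs
  obtain ⟨W, ⟨hW, hWgen⟩, hWs⟩ := hs
  obtain ⟨V, hV, hWV⟩ := Submodule.exists_le_baseChange L W
  obtain ⟨C, hC⟩ := hdim V hV
  let d : ℕ → ℕ := fun i => Module.finrank L (orbitSpan τ v (stdFiltration L W i))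
  have hd : ∀ i : ℕ, (d i : ℝ≥0) ≤ C * ((i : ℝ≥0) + 1) ^ (t : ℝ) := by
    intro i
    refine le_trans ?_ (hC i)
    have : orbitSpan τ v (stdFiltration L W i) ≤
        orbitSpan τ v ((stdFiltration K V i).baseChange L) := by
      rw [baseChange_stdFiltration]
      exact Submodule.map_mono (stdFiltration_mono_left hWV i)
    exact_mod_cast Submodule.finrank_mono this
  -- With `j ≤ i ^ s`, the factor `d j` contributes the exponent `t * s`. The factor `d (i + j)`
  -- contributes `t * max s 1`, as `i + j` is of order at most `i ^ max s 1`.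
  have hmain : ∀ᶠ i : ℕ in atTop, (Module.finrank L (stdFiltration L W i) : ℝ≥0) ≤
      (C * C * 2 ^ (t : ℝ) * 2 ^ (t : ℝ)) *
        ((i : ℝ≥0) + 1) ^ ((t * (s + max s 1) : ℝ≥0) : ℝ) := by
    filter_upwards [eventually_le_of_growthDegree_lt hWs] with i hi
    have hne : leftReturnFunction L W i ≠ ⊤ := by
      intro h
      rw [h, ENat.toENNReal_top, top_le_iff] at hi
      exact ENNReal.rpow_ne_top_of_nonneg s.coe_nonneg (ENNReal.natCast_ne_top i) hi
    obtain ⟨j, hj, hjW⟩ := exists_eq_leftReturnFunction hne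
    rw [hj, ENat.toENNReal_coe, ← ENNReal.coe_natCast, ← ENNReal.coe_natCast,
      ← ENNReal.coe_rpow_of_nonneg _ s.coe_nonneg, ENNReal.coe_le_coe] at hi
    have h1 : (1 : ℝ≥0) ≤ (i : ℝ≥0) + 1 := le_add_self
    have hjs : (j : ℝ≥0) ≤ ((i : ℝ≥0) + 1) ^ (s : ℝ) :=
      hi.trans (NNReal.rpow_le_rpow le_self_add s.coe_nonneg)
    have hone : ∀ q : ℝ≥0, (1 : ℝ≥0) ≤ ((i : ℝ≥0) + 1) ^ (q : ℝ) := fun q =>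
      NNReal.one_le_rpow h1 q.coe_nonneg
    have hb1 : (d j : ℝ≥0) ≤ C * (2 ^ (t : ℝ) * ((i : ℝ≥0) + 1) ^ ((s : ℝ) * t)) := by
      refine (hd j).trans ?_
      rw [NNReal.rpow_mul, ← NNReal.mul_rpow]
      gcongr
      rw [two_mul]
      exact add_le_add hjs (hone s)
    have hb2 : (d (i + j) : ℝ≥0) ≤
        C * (2 ^ (t : ℝ) * ((i : ℝ≥0) + 1) ^ (((max s 1 : ℝ≥0) : ℝ) * t)) := by
      refine (hd (i + j)).trans ?_
      rw [NNReal.rpow_mul, ← NNReal.mul_rpow]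
      gcongr
      have e1 : (j : ℝ≥0) ≤ ((i : ℝ≥0) + 1) ^ ((max s 1 : ℝ≥0) : ℝ) :=
        hjs.trans (NNReal.rpow_le_rpow_of_exponent_le h1 (by exact_mod_cast le_max_left s 1))
      have e2 : (i : ℝ≥0) + 1 ≤ ((i : ℝ≥0) + 1) ^ ((max s 1 : ℝ≥0) : ℝ) := by
        conv_lhs => rw [← NNReal.rpow_one ((i : ℝ≥0) + 1)]
        exact NNReal.rpow_le_rpow_of_exponent_le h1 (by exact_mod_cast le_max_right s 1)
      rw [two_mul, Nat.cast_add, add_right_comm]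
      exact add_le_add e2 e1
    calc (Module.finrank L (stdFiltration L W i) : ℝ≥0) ≤ (d j : ℝ≥0) * (d (i + j) : ℝ≥0) := by
          exact_mod_cast finrank_stdFiltration_le_mul τ hv W hjW
      _ ≤ _ := mul_le_mul' hb1 hb2
      _ = _ := by
        have : ((t * (s + max s 1) : ℝ≥0) : ℝ) = (s : ℝ) * t + ((max s 1 : ℝ≥0) : ℝ) * t := by
          push_cast; ring
        rw [this, NNReal.rpow_add (lt_of_lt_of_le one_pos h1).ne']
        ring
  refine iSup₂_le fun V' hV' => ?_
  obtain ⟨c, hc⟩ := exists_le_stdFiltration hWgen (V'.baseChange L)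
  set q : ℝ≥0 := t * (s + max s 1)
  -- `c + 1` replaces `c`, which may be zero, because `hmain` holds only for large arguments.
  have ht : Tendsto (fun i : ℕ => (c + 1) * i) atTop atTop :=
    tendsto_atTop_mono (fun i => show i ≤ (c + 1) * i by nlinarith) tendsto_id
  refine growthDegree_natCast_le
    (C := (C * C * 2 ^ (t : ℝ) * 2 ^ (t : ℝ)) * ((c + 1 : ℕ) : ℝ≥0) ^ (q : ℝ)) ?_
  filter_upwards [ht.eventually hmain] with i hi
  have h1 : Module.finrank K (stdFiltration K V' i) ≤
      Module.finrank L (stdFiltration L W ((c + 1) * i)) := by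
    rw [← Submodule.finrank_baseChange L, baseChange_stdFiltration]
    exact Submodule.finrank_mono ((stdFiltration_le_of_le hc i).trans
      (stdFiltration_mono W (by gcongr; lia)))
  calc (Module.finrank K (stdFiltration K V' i) : ℝ≥0)
      ≤ Module.finrank L (stdFiltration L W ((c + 1) * i)) := by exact_mod_cast h1
    _ ≤ _ := hi
    _ ≤ _ := by
      rw [mul_assoc _ (((c + 1 : ℕ) : ℝ≥0) ^ (q : ℝ)), ← NNReal.mul_rpow]
      gcongr
      push_cast
      rw [mul_add, mul_one]
      gcongr
      exact le_add_self

end FilterInequality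

/-! ### Scalar extension of a representation. -/

section Representation

variable {K : Type*} {A : Type*} [Field K] [Ring A] [Algebra K A]
  (L : Type*) [Field L] [Algebra K L]
  {T : Type*} [CommRing T] [Algebra K T] [Algebra T L] [IsScalarTower K T L]
  {E : Type*} [AddCommGroup E] [Module K E] [Module T E] [IsScalarTower K T E]

/-- A representation of `A` by `T`-linear maps of `E` extends to `L ⊗ A` acting on `L ⊗ E`. -/
noncomputable def baseChangeRep (ρ : A →ₐ[K] Module.End T E) : L ⊗[K] A →ₐ[L] Module.End L (L ⊗[T] E) :=
  Algebra.TensorProduct.lift (Algebra.ofId L _)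
    (((Module.End.baseChangeHom T L E).restrictScalars K).comp ρ)
    fun x _ => (Algebra.commutes x _ : Commute (Algebra.ofId L (Module.End L (L ⊗[T] E)) x) _)

lemma baseChangeRep_one_tmul (ρ : A →ₐ[K] Module.End T E) (a : A) (e : E) :
    baseChangeRep L ρ (1 ⊗ₜ a) (1 ⊗ₜ e) = 1 ⊗ₜ ρ a e := by
  have h : baseChangeRep L ρ (1 ⊗ₜ a) = Algebra.ofId L (Module.End L (L ⊗[T] E)) 1 *
      ((Module.End.baseChangeHom T L E).restrictScalars K).comp ρ a :=
    Algebra.TensorProduct.lift_tmul ..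
  rw [h, map_one, one_mul]
  rfl

/-- The orbit has an `L`-spanning set indexed by `U` itself, so an `L`-basis of it can be lifted to
elements of `U`. -/
lemma orbitSpan_baseChangeRep (ρ : A →ₐ[K] Module.End T E) (e : E) (U : Submodule K A) :
    orbitSpan (baseChangeRep L ρ) (1 ⊗ₜ e) (U.baseChange L) =
      Submodule.span L ((fun a => (1 : L) ⊗ₜ[T] ρ a e) '' (U : Set A)) := by
  rw [orbitSpan, Submodule.baseChange_eq_span, Submodule.map_span, Submodule.map_coe,
    Set.image_image]
  congr 1
  refine Set.image_congr fun a _ => ?_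
  exact baseChangeRep_one_tmul L ρ a e

end Representation

/-! ### Growth of an algebra over a polynomial subalgebra. -/

section PolynomialSubalgebra

variable {K : Type u} {A : Type v} [Field K] [Ring A] [Algebra K A] {n : ℕ}

lemma pow_mem_stdFiltration {V : Submodule K A} {x : A} (hx : x ∈ V) (k : ℕ) :
    x ^ k ∈ stdFiltration K V k :=
  Submodule.pow_mem_pow _ (Submodule.mem_sup_right hx) k

lemma algHom_monomial_mem_stdFiltration {σ : Type*} [Fintype σ]
    (φ : MvPolynomial σ K →ₐ[K] A) {V : Submodule K A} (hV : ∀ k, φ (MvPolynomial.X k) ∈ V)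
    (α : σ →₀ ℕ) : φ (MvPolynomial.monomial α 1) ∈ stdFiltration K V (∑ k, α k) := by
  classical
  rw [MvPolynomial.monomial_eq, map_one, one_mul, Finsupp.prod_fintype _ _ (by simp)]
  suffices h : ∀ s : Finset σ,
      φ (∏ k ∈ s, MvPolynomial.X k ^ α k) ∈ stdFiltration K V (∑ k ∈ s, α k) from h _
  intro s
  induction s using Finset.induction_on with
  | empty => simpa using one_mem_stdFiltration V 0
  | insert k s hk ih =>
    rw [Finset.prod_insert hk, Finset.sum_insert hk, map_mul, map_pow]
    exact mul_mem_stdFiltration (pow_mem_stdFiltration (hV k) _) ih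

/-- The `l ^ n` monomials with all exponents below `l` are independent over `K`, so their products
with a family independent over the polynomial ring remain independent. Their degrees are at most `n
* l`. -/
lemma card_mul_pow_le_finrank_stdFiltration (φ : MvPolynomial (Fin n) K →ₐ[K] A)
    [Module (MvPolynomial (Fin n) K) A] [IsScalarTower K (MvPolynomial (Fin n) K) A]
    (hsmul : ∀ (p : MvPolynomial (Fin n) K) (a : A), p • a = a * φ p)
    {V : Submodule K A} [FiniteDimensional K V] (hV : ∀ k, φ (MvPolynomial.X k) ∈ V)
    {ι : Type*} [Fintype ι] {w : ι → A} (hw : LinearIndependent (MvPolynomial (Fin n) K) w) {i : ℕ}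
    (hwi : ∀ k, w k ∈ stdFiltration K V i) (l : ℕ) :
    Fintype.card ι * l ^ n ≤ Module.finrank K (stdFiltration K V (i + n * l)) := by
  let α : (Fin n → Fin l) → Fin n →₀ ℕ := fun β => Finsupp.equivFunOnFinite.symm fun k => (β k : ℕ)
  have hα : Function.Injective α := fun β β' h => by
    funext k
    exact Fin.ext (by simpa [α] using DFunLike.congr_fun h k)
  have hb : LinearIndependent K fun β => MvPolynomial.monomial (α β) (1 : K) := by
    have := (MvPolynomial.basisMonomials (Fin n) K).linearIndependent.comp α hα
    simpa [Function.comp_def] using this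
  have hli := linearIndependent_smul hb hw
  have hmem : ∀ p : (Fin n → Fin l) × ι,
      MvPolynomial.monomial (α p.1) (1 : K) • w p.2 ∈ stdFiltration K V (i + n * l) := by
    intro p
    rw [hsmul]
    refine mul_mem_stdFiltration (hwi p.2)
      (stdFiltration_mono V ?_ (algHom_monomial_mem_stdFiltration φ hV _))
    calc ∑ k, α p.1 k ≤ ∑ _k : Fin n, l :=
          Finset.sum_le_sum fun k _ => by simp [α]
      _ = n * l := by simp
  have hli' : LinearIndependent K fun p : (Fin n → Fin l) × ι =>
      (⟨_, hmem p⟩ : stdFiltration K V (i + n * l)) :=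
    LinearIndependent.of_comp (Submodule.subtype _) hli
  have := hli'.fintype_card_le_finrank
  rw [Fintype.card_prod, Fintype.card_fun, Fintype.card_fin, Fintype.card_fin] at this
  rwa [mul_comm]

lemma le_of_forall_rpow_le {n r : ℝ} {C : ℝ≥0}
    (h : ∀ i : ℕ, ((i : ℝ≥0) + 1) ^ n ≤ C * ((i : ℝ≥0) + 1) ^ r) : n ≤ r := by
  by_contra! hlt
  have ht : Tendsto (fun i : ℕ => ((i : ℝ≥0) + 1) ^ (n - r)) atTop atTop := by
    refine (NNReal.tendsto_rpow_atTop (sub_pos.mpr hlt)).comp ?_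
    exact tendsto_atTop_mono (fun _ => le_self_add) (tendsto_natCast_atTop_atTop (R := ℝ≥0))
  obtain ⟨i, hi⟩ := (ht.eventually_gt_atTop C).exists
  have h0 : ((i : ℝ≥0) + 1) ≠ 0 := by positivity
  have := h i
  rw [← sub_add_cancel n r, NNReal.rpow_add h0] at this
  exact absurd (le_of_mul_le_mul_right this (by positivity)) (not_le.mpr hi)

/-- The bounds on growth that a polynomial subalgebra in `n` variables imposes. -/
lemma exists_bound_of_polynomialSubalgebra [Nontrivial A] (φ : MvPolynomial (Fin n) K →ₐ[K] A)
    (hφ : Function.Injective φ)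
    [Module (MvPolynomial (Fin n) K) A] [IsScalarTower K (MvPolynomial (Fin n) K) A]
    (hsmul : ∀ (p : MvPolynomial (Fin n) K) (a : A), p • a = a * φ p)
    {r : ℝ≥0} (hr : gkDim K A < r) :
    (n : ℝ≥0) ≤ r ∧ ∀ V : Submodule K A, FiniteDimensional K V → ∃ C : ℝ≥0, ∀ (i m : ℕ),
      (∃ w : Fin m → A, LinearIndependent (MvPolynomial (Fin n) K) w ∧
        ∀ k, w k ∈ stdFiltration K V i) →
      (m : ℝ≥0) ≤ C * ((i : ℝ≥0) + 1) ^ ((r : ℝ) - n) := by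
  have key : ∀ V : Submodule K A, FiniteDimensional K V → ∃ C : ℝ≥0, ∀ (i m : ℕ),
      (∃ w : Fin m → A, LinearIndependent (MvPolynomial (Fin n) K) w ∧
        ∀ k, w k ∈ stdFiltration K V i) →
      (m : ℝ≥0) * ((i : ℝ≥0) + 1) ^ (n : ℝ) ≤ C * ((i : ℝ≥0) + 1) ^ (r : ℝ) := by
    intro V hV
    -- The variables are adjoined to `V` so that monomials have controlled degree in the filtration.
    let V' := V ⊔ Submodule.span K (Set.range fun k => φ (MvPolynomial.X k))
    have : FiniteDimensional K (Submodule.span K (Set.range fun k => φ (MvPolynomial.X k))) :=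
      FiniteDimensional.span_of_finite K (Set.finite_range _)
    have hX : ∀ k, φ (MvPolynomial.X k) ∈ V' := fun k =>
      Submodule.mem_sup_right (Submodule.subset_span ⟨k, rfl⟩)
    obtain ⟨C, hC⟩ := exists_bound_of_growthDegree_natCast_lt
      ((le_iSup₂ (f := fun (V : Submodule K A) (_ : FiniteDimensional K V) =>
        growthDegree fun i => (Module.finrank K (stdFiltration K V i) : ℕ∞)) V'
          inferInstance).trans_lt hr)
    refine ⟨C * ((n + 1 : ℕ) : ℝ≥0) ^ (r : ℝ), ?_⟩
    rintro i m ⟨w, hw, hwi⟩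
    -- Taking `l = i + 1` gives the factor `(i + 1) ^ n`, while the filtration degree stays linear
    -- in `i`.
    have h1 := card_mul_pow_le_finrank_stdFiltration φ hsmul hX hw (i := i)
      (fun k => stdFiltration_mono_left le_sup_left i (hwi k)) (i + 1)
    rw [Fintype.card_fin] at h1
    calc (m : ℝ≥0) * ((i : ℝ≥0) + 1) ^ (n : ℝ) = ((m * (i + 1) ^ n : ℕ) : ℝ≥0) := by
          rw [NNReal.rpow_natCast]; push_cast; rfl
      _ ≤ _ := Nat.cast_le.mpr h1
      _ ≤ _ := hC _
      _ ≤ _ := by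
        rw [mul_assoc, ← NNReal.mul_rpow]
        gcongr
        have : i + n * (i + 1) + 1 ≤ (n + 1) * (i + 1) := by nlinarith
        exact_mod_cast this
  constructor
  -- The single independent vector `1` already forces growth of degree `n`.
  · obtain ⟨C, hC⟩ := key ⊥ inferInstance
    have : (n : ℝ) ≤ r := le_of_forall_rpow_le (C := C) fun i => by
      have hli : LinearIndependent (MvPolynomial (Fin n) K) fun _ : Fin 1 => (1 : A) := by
        rw [Fintype.linearIndependent_iff]
        intro g hg k
        refine hφ ?_
        simpa [hsmul, Subsingleton.elim k 0] using hg
      simpa using hC i 1 ⟨fun _ => 1, hli, fun _ => one_mem_stdFiltration _ _⟩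
    exact_mod_cast this
  · intro V hV
    obtain ⟨C, hC⟩ := key V hV
    refine ⟨C, fun i m hw => ?_⟩
    have h0 : ((i : ℝ≥0) + 1) ≠ 0 := by positivity
    have := hC i m hw
    rw [← sub_add_cancel (r : ℝ) n, NNReal.rpow_add h0, ← mul_assoc] at this
    exact le_of_mul_le_mul_right this (by positivity)

/-- `A` as a module over a polynomial subalgebra, acting by right multiplication. -/
noncomputable abbrev rightMulModule (φ : MvPolynomial (Fin n) K →ₐ[K] A) : Module (MvPolynomial (Fin n) K) A :=
  Module.compHom A (φ.toRingHom.toOpposite fun x y => (Commute.all x y).map φ)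

/-- The filter inequality is applied to `L ⊗ A` acting on `L ⊗ A` taken over the polynomial ring,
with vector `1 ⊗ 1`. Passing to rank over the polynomial ring lowers the growth exponent of the
orbit from `r` to `r - n`. The first conjunct ensures that the truncated subtraction `r - n` is the
true one. -/
theorem bounds_of_polynomialSubalgebra [Nontrivial A] (φ : MvPolynomial (Fin n) K →ₐ[K] A)
    (hφ : Function.Injective φ) {r : ℝ≥0} (hr : gkDim K A < r) :
    (n : ℝ≥0) ≤ r ∧ ∀ s : ℝ≥0, leftFilterDim (RatFunField K n) (RatFunField K n ⊗[K] A) < s →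
      gkDim K A ≤ (((r - n) * (s + max s 1) : ℝ≥0) : ℝ≥0∞) := by
  let _ := rightMulModule φ
  have hsmul : ∀ (p : MvPolynomial (Fin n) K) (a : A), p • a = a * φ p := fun _ _ => rfl
  have : IsScalarTower K (MvPolynomial (Fin n) K) A :=
    ⟨fun k p a => by rw [hsmul, hsmul, map_smul, mul_smul_comm]⟩
  obtain ⟨hn, hbound⟩ := exists_bound_of_polynomialSubalgebra φ hφ hsmul hr
  refine ⟨hn, fun s hs => ?_⟩
  let L := RatFunField K n
  have hcomm : SMulCommClass A (MvPolynomial (Fin n) K) A :=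
    ⟨fun a p x => by rw [hsmul, hsmul, smul_eq_mul, smul_eq_mul, mul_assoc]⟩
  let ρ : A →ₐ[K] Module.End (MvPolynomial (Fin n) K) A :=
    Algebra.lsmul K (MvPolynomial (Fin n) K) A
  -- The vector is nonzero because `L` is flat over the polynomial ring and `p ↦ φ p` is injective.
  have hv : (1 : L) ⊗ₜ[MvPolynomial (Fin n) K] (1 : A) ≠ 0 := by
    have hinj : Function.Injective
        ((LinearMap.toSpanSingleton (MvPolynomial (Fin n) K) A 1).lTensor L) := by
      refine Module.Flat.lTensor_preserves_injective_linearMap _ fun p q h => hφ ?_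
      simpa [hsmul] using h
    intro h0
    have h1 : (1 : L) ⊗ₜ[MvPolynomial (Fin n) K] (1 : MvPolynomial (Fin n) K) = 0 := by
      refine hinj ?_
      simpa using h0
    have := congrArg (TensorProduct.rid (MvPolynomial (Fin n) K) L) h1
    simp at this
  refine gkDim_le_of_representation (baseChangeRep L ρ) hv (fun V hV => ?_) hs
  obtain ⟨C, hC⟩ := hbound V hV
  refine ⟨C, fun i => ?_⟩
  rw [NNReal.coe_sub hn]
  refine hC i _ ?_
  have hfin := finiteDimensional_orbitSpan (baseChangeRep L ρ) (1 ⊗ₜ 1)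
    ((stdFiltration K V i).baseChange L)
  rw [orbitSpan_baseChangeRep] at hfin ⊢
  -- A basis of the orbit is chosen among the vectors `1 ⊗ a` with `a` in `A_i`; the elements `a`
  -- are then independent over the polynomial ring, and `hC` bounds their number.
  obtain ⟨f, hf, -, hli⟩ := Submodule.exists_fun_fin_finrank_span_eq L
    ((fun a => (1 : L) ⊗ₜ[MvPolynomial (Fin n) K] ρ a 1) '' (stdFiltration K V i : Set A))
  choose w hw hwf using hf
  refine ⟨w, ?_, hw⟩
  have h2 : LinearIndependent (MvPolynomial (Fin n) K) f := hli.restrict_scalars' _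
  refine LinearIndependent.of_comp (TensorProduct.mk (MvPolynomial (Fin n) K) L A 1) ?_
  convert h2 using 1
  funext k
  rw [← hwf k]
  exact congrArg (fun x : A => (1 : L) ⊗ₜ[MvPolynomial (Fin n) K] x) (mul_one (w k)).symm

end PolynomialSubalgebra

/-! ### Growth of commutative algebras and Noether normalization. -/

section CommutativeGrowth

variable {K : Type*} {B : Type*} [Field K] [CommRing B] [Algebra K B]

lemma Submodule.finrank_mul_le {A : Type*} [Ring A] [Algebra K A] (M N : Submodule K A)
    [FiniteDimensional K M] [FiniteDimensional K N] :
    Module.finrank K (M * N : Submodule K A) ≤ Module.finrank K M * Module.finrank K N := by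
  rw [← Submodule.mulMap_range, ← Module.finrank_tensorProduct]
  exact LinearMap.finrank_range_le _

lemma MvPolynomial.restrictTotalDegree_mul_le (σ : Type*) (D E : ℕ) :
    MvPolynomial.restrictTotalDegree σ K D * MvPolynomial.restrictTotalDegree σ K E ≤
      MvPolynomial.restrictTotalDegree σ K (D + E) := by
  rw [Submodule.mul_le]
  intro p hp q hq
  rw [MvPolynomial.mem_restrictTotalDegree] at *
  exact (MvPolynomial.totalDegree_mul p q).trans (add_le_add hp hq)

lemma MvPolynomial.restrictTotalDegree_mono (σ : Type*) :
    Monotone (MvPolynomial.restrictTotalDegree σ K) := fun D E h p hp => by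
  rw [MvPolynomial.mem_restrictTotalDegree] at *
  exact hp.trans h

lemma MvPolynomial.finrank_restrictTotalDegree_le (s D : ℕ) :
    Module.finrank K (MvPolynomial.restrictTotalDegree (Fin s) K D) ≤ (D + 1) ^ s := by
  let m : (Fin s → Fin (D + 1)) → MvPolynomial (Fin s) K := fun β =>
    MvPolynomial.monomial (Finsupp.equivFunOnFinite.symm fun k => (β k : ℕ)) 1
  have hle : MvPolynomial.restrictTotalDegree (Fin s) K D ≤ Submodule.span K (Set.range m) := by
    intro p hp
    have hp' := MvPolynomial.restrictTotalDegree_le_restrictDegree _ _ D hp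
    rw [MvPolynomial.mem_restrictDegree] at hp'
    rw [p.as_sum]
    refine Submodule.sum_mem _ fun α hα => ?_
    rw [← mul_one (MvPolynomial.coeff α p), ← smul_eq_mul, ← MvPolynomial.smul_monomial]
    refine Submodule.smul_mem _ _ (Submodule.subset_span ⟨fun k => ⟨α k, ?_⟩, ?_⟩)
    · exact Nat.lt_succ_of_le (hp' α hα k)
    · simp only [m]
      congr 1
      ext k
      simp
  have : FiniteDimensional K (Submodule.span K (Set.range m)) :=
    FiniteDimensional.span_of_finite K (Set.finite_range m)
  refine (Submodule.finrank_mono hle).trans ((finrank_range_le_card m).trans_eq ?_)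
  simp

/-- A commutative algebra that is finite over a polynomial algebra in `s` variables grows at most
like a polynomial of degree `s`. -/
lemma exists_finrank_stdFiltration_le {s : ℕ} (φ : MvPolynomial (Fin s) K →ₐ[K] B)
    (hφ : φ.Finite) (V : Submodule K B) [FiniteDimensional K V] :
    ∃ C : ℝ≥0, ∀ i : ℕ,
      (Module.finrank K (stdFiltration K V i) : ℝ≥0) ≤ C * ((i : ℝ≥0) + 1) ^ (s : ℝ) := by
  let Q : ℕ → Submodule K B := fun D =>
    (MvPolynomial.restrictTotalDegree (Fin s) K D).map φ.toLinearMap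
  have hQmono : Monotone Q := fun D E h =>
    Submodule.map_mono (MvPolynomial.restrictTotalDegree_mono _ h)
  have hQmul : ∀ D E, Q D * Q E ≤ Q (D + E) := fun D E => by
    simp only [Q]
    rw [← Submodule.map_mul]
    exact Submodule.map_mono (MvPolynomial.restrictTotalDegree_mul_le _ D E)
  let _ := φ.toRingHom.toAlgebra
  obtain ⟨b, hb⟩ := Module.finite_def.mp (hφ : Module.Finite (MvPolynomial (Fin s) K) B)
  let U : Submodule K B := Submodule.span K (b : Set B)
  have hU : FiniteDimensional K U := FiniteDimensional.span_finset K b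
  -- `G D` consists of combinations of the module generators with coefficients of total degree at
  -- most `D`. Its dimension is at most `(D + 1) ^ s * dim U`.
  let G : ℕ → Submodule K B := fun D => Q D * U
  have hGmono : Monotone G := fun D E h => mul_le_mul' (hQmono h) le_rfl
  have hQG : ∀ D E, Q D * G E ≤ G (D + E) := fun D E => by
    simp only [G]
    rw [← mul_assoc]
    exact mul_le_mul' (hQmul D E) le_rfl
  have hQmem : ∀ p : MvPolynomial (Fin s) K, φ p ∈ Q p.totalDegree := fun p =>
    ⟨p, (MvPolynomial.mem_restrictTotalDegree _ _ _).mpr le_rfl, rfl⟩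
  have hG : ∀ x : B, ∃ D, x ∈ G D := by
    intro x
    have hx : x ∈ Submodule.span (MvPolynomial (Fin s) K) (b : Set B) := hb ▸ Submodule.mem_top
    induction hx using Submodule.span_induction with
    | mem x hx =>
      refine ⟨0, ?_⟩
      have h1 : φ 1 ∈ Q 0 := by simpa using hQmem 1
      rw [map_one] at h1
      simpa using Submodule.mul_mem_mul h1 (Submodule.subset_span hx : x ∈ U)
    | zero => exact ⟨0, zero_mem _⟩
    | add x y _ _ hx hy =>
      obtain ⟨i, hi⟩ := hx
      obtain ⟨j, hj⟩ := hy
      exact ⟨max i j, add_mem (hGmono (le_max_left i j) hi) (hGmono (le_max_right i j) hj)⟩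
    | smul p x _ hx =>
      obtain ⟨i, hi⟩ := hx
      refine ⟨p.totalDegree + i, hQG _ _ ?_⟩
      rw [Algebra.smul_def]
      exact Submodule.mul_mem_mul (hQmem p) hi
  have hfg : ∀ W : Submodule K B, W.FG → ∃ c, W ≤ G c := fun W hW =>
    hW.exists_le_of_monotone hGmono fun x _ => hG x
  have hUfg : U.FG := (Submodule.fg_iff_finiteDimensional U).mpr inferInstance
  have hVfg : V.FG := (Submodule.fg_iff_finiteDimensional V).mpr inferInstance
  have h1fg : (1 : Submodule K B).FG := ⟨{1}, by rw [Finset.coe_singleton, Submodule.one_eq_span]⟩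
  obtain ⟨e, he⟩ := hfg 1 h1fg
  -- Multiplying a module generator by `1 ⊔ V` costs coefficients of degree at most `c`, so each
  -- further factor of the filtration adds `c`.
  obtain ⟨c, hc⟩ := hfg ((1 ⊔ V) * U) ((h1fg.sup hVfg).mul hUfg)
  have hstep : ∀ i, stdFiltration K V i ≤ G (c * i + e) := by
    intro i
    induction i with
    | zero => simpa [stdFiltration_zero] using he
    | succ i ih =>
      rw [stdFiltration_succ]
      calc stdFiltration K V i * (1 ⊔ V) ≤ G (c * i + e) * (1 ⊔ V) := mul_le_mul' ih le_rfl
        _ = Q (c * i + e) * ((1 ⊔ V) * U) := by simp only [G]; rw [mul_assoc, mul_comm U]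
        _ ≤ Q (c * i + e) * G c := mul_le_mul' le_rfl hc
        _ ≤ G (c * i + e + c) := hQG _ _
        _ = G (c * (i + 1) + e) := by congr 1; ring
  refine ⟨((c + e + 1 : ℕ) : ℝ≥0) ^ s * (Module.finrank K U : ℝ≥0), fun i => ?_⟩
  have hQfin : ∀ D, FiniteDimensional K (Q D) := fun D => inferInstance
  have hGfin : ∀ D, FiniteDimensional K (G D) := fun D =>
    (Submodule.fg_iff_finiteDimensional _).mp
      (((Submodule.fg_iff_finiteDimensional _).mpr (hQfin D)).mul hUfg)
  have h1 : Module.finrank K (stdFiltration K V i) ≤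
      ((c + e + 1) * (i + 1)) ^ s * Module.finrank K U := by
    refine (Submodule.finrank_mono (hstep i)).trans ((Submodule.finrank_mul_le _ _).trans ?_)
    refine Nat.mul_le_mul_right _ ((Submodule.finrank_map_le _ _).trans
      ((MvPolynomial.finrank_restrictTotalDegree_le s _).trans ?_))
    refine Nat.pow_le_pow_left ?_ s
    nlinarith
  calc (Module.finrank K (stdFiltration K V i) : ℝ≥0)
      ≤ ((((c + e + 1) * (i + 1)) ^ s * Module.finrank K U : ℕ) : ℝ≥0) := Nat.cast_le.mpr h1
    _ = _ := by
      rw [NNReal.rpow_natCast, Nat.cast_mul, Nat.cast_pow, Nat.cast_mul, mul_pow, mul_right_comm,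
        Nat.cast_succ i]

/-- The Gelfand-Kirillov dimension of a commutative algebra is bounded by the numbers of variables
of its polynomial subalgebras. -/
lemma gkDim_le_of_forall_polynomialSubalgebra [Nontrivial B] {X : ℝ≥0∞}
    (h : ∀ (s : ℕ) (φ : MvPolynomial (Fin s) K →ₐ[K] B), Function.Injective φ → (s : ℝ≥0∞) ≤ X) :
    gkDim K B ≤ X := by
  refine iSup₂_le fun V hV => ?_
  let R := Algebra.adjoin K (V : Set B)
  have hR : Algebra.FiniteType K R := by
    obtain ⟨t, ht⟩ := (Submodule.fg_iff_finiteDimensional V).mpr hV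
    refine R.fg_iff_finiteType.mp ⟨t, ?_⟩
    simp only [R]
    rw [← ht, Algebra.adjoin_span]
  -- Noether normalization: the subalgebra generated by `V` is finite over a polynomial ring in `s`
  -- variables, so it grows with degree at most `s`.
  obtain ⟨s, g, hg, hgf⟩ := exists_finite_inj_algHom_of_fg K R
  let V' : Submodule K R := V.comap R.val.toLinearMap
  have hVV' : V'.map R.val.toLinearMap = V := by
    refine Submodule.map_comap_eq_of_le fun x hx => ⟨⟨x, Algebra.subset_adjoin hx⟩, rfl⟩
  have hinj : Function.Injective R.val.toLinearMap := Subtype.val_injective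
  have hV' : FiniteDimensional K V' := by
    have e := Submodule.equivMapOfInjective R.val.toLinearMap hinj V'
    rw [hVV'] at e
    exact Module.Finite.equiv e.symm
  obtain ⟨C, hC⟩ := exists_finrank_stdFiltration_le g hgf V'
  have hfin : ∀ i, Module.finrank K (stdFiltration K V i) =
      Module.finrank K (stdFiltration K V' i) := by
    intro i
    rw [← hVV', ← map_stdFiltration]
    exact (Submodule.equivMapOfInjective R.val.toLinearMap hinj _).finrank_eq.symm
  have h1 : growthDegree (fun i => (Module.finrank K (stdFiltration K V i) : ℕ∞)) ≤ (s : ℝ≥0) := by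
    refine growthDegree_natCast_le (C := C) (Eventually.of_forall fun i => ?_)
    rw [hfin]
    simpa using hC i
  refine h1.trans ?_
  rw [ENNReal.coe_natCast]
  exact h s (R.val.comp g) (Subtype.val_injective.comp hg)

end CommutativeGrowth

/-! ### Finiteness of the growth of `A(P)`. -/

section Poisson

variable {K : Type u} {P : Type v} [Field K] [CommRing P] [Algebra K P] [PoissonAlgebra K P]

open PoissonAlgebra

/-- By the Leibniz rule, the degree shift of a derivation is bounded by its shift on the generators.
-/
lemma exists_bracket_mem_stdFiltration {V₀ : Submodule K P} [FiniteDimensional K V₀]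
    (hV₀ : Algebra.adjoin K (V₀ : Set P) = ⊤) (a : P) :
    ∃ c, ∀ D, ∀ p ∈ stdFiltration K V₀ D, bracket (K := K) a p ∈ stdFiltration K V₀ (D + c) := by
  have h1fg : (1 : Submodule K P).FG := ⟨{1}, by rw [Finset.coe_singleton, Submodule.one_eq_span]⟩
  have hfg : ((1 ⊔ V₀).map (bracket (K := K) a)).FG :=
    (h1fg.sup ((Submodule.fg_iff_finiteDimensional V₀).mpr inferInstance)).map _
  obtain ⟨c, hc⟩ := hfg.exists_le_of_monotone (stdFiltration_mono V₀)
    fun x _ => exists_mem_stdFiltration hV₀ x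
  refine ⟨c, fun D => ?_⟩
  induction D with
  | zero =>
    intro p hp
    rw [stdFiltration_zero] at hp
    rw [zero_add]
    exact hc ⟨p, Submodule.mem_sup_left hp, rfl⟩
  | succ D ih =>
    intro p hp
    rw [stdFiltration_succ] at hp
    induction hp using Submodule.mul_induction_on' with
    | mem_mul_mem x hx y hy =>
      rw [leibniz]
      refine add_mem ?_ ?_
      · have hy' : y ∈ stdFiltration K V₀ 1 := by rwa [stdFiltration, pow_one]
        have := mul_mem_stdFiltration (ih x hx) hy'
        rwa [add_right_comm] at this
      · exact stdFiltration_mono V₀ (by lia) (mul_mem_stdFiltration hx (hc ⟨y, hy, rfl⟩))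
    | add x _ y _ hx hy => rw [map_add]; exact add_mem hx hy

/-- The operators in `A(P)` that raise the filtration degree on `P` by at most `c`. -/
def degreeRaising (V₀ : Submodule K P) (c : ℕ) : Submodule K (opAlgebra K P) where
  carrier := {f | ∀ D, ∀ p ∈ stdFiltration K V₀ D, f.1 p ∈ stdFiltration K V₀ (D + c)}
  zero_mem' := fun _ _ _ => zero_mem _
  add_mem' := fun hf hg D p hp => add_mem (hf D p hp) (hg D p hp)
  smul_mem' := fun k _ hf D p hp => Submodule.smul_mem _ k (hf D p hp)

lemma degreeRaising_mono (V₀ : Submodule K P) : Monotone (degreeRaising V₀) :=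
  fun _ _ h _ hf D p hp => stdFiltration_mono V₀ (by lia) (hf D p hp)

lemma degreeRaising_mul_le (V₀ : Submodule K P) (c e : ℕ) :
    degreeRaising V₀ c * degreeRaising V₀ e ≤ degreeRaising V₀ (c + e) := by
  rw [Submodule.mul_le]
  intro f hf g hg D p hp
  have := hf _ _ (hg D p hp)
  rwa [add_assoc, add_comm e] at this

lemma exists_mem_degreeRaising {V₀ : Submodule K P} [FiniteDimensional K V₀]
    (hV₀ : Algebra.adjoin K (V₀ : Set P) = ⊤) (f : opAlgebra K P) :
    ∃ c, f ∈ degreeRaising V₀ c := by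
  obtain ⟨f, hf⟩ := f
  induction hf using Algebra.adjoin_induction with
  | mem f hf =>
    rcases hf with ⟨a, rfl⟩ | ⟨a, rfl⟩
    · obtain ⟨c, hc⟩ := exists_mem_stdFiltration hV₀ a
      refine ⟨c, fun D p hp => ?_⟩
      rw [add_comm]
      exact mul_mem_stdFiltration hc hp
    · exact exists_bracket_mem_stdFiltration hV₀ a
  | algebraMap k => exact ⟨0, fun D p hp => Submodule.smul_mem _ k hp⟩
  | add f g hf hg ihf ihg =>
    obtain ⟨i, hi⟩ := ihf
    obtain ⟨j, hj⟩ := ihg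
    exact ⟨max i j, add_mem (degreeRaising_mono V₀ (le_max_left i j) hi)
      (degreeRaising_mono V₀ (le_max_right i j) hj)⟩
  | mul f g hf hg ihf ihg =>
    obtain ⟨i, hi⟩ := ihf
    obtain ⟨j, hj⟩ := ihg
    exact ⟨i + j, degreeRaising_mul_le V₀ i j (Submodule.mul_mem_mul hi hj)⟩

/-- The operator algebra has finite Gelfand-Kirillov dimension as soon as a left filter dimension
is finite. -/
lemma gkDim_opAlgebra_ne_top [Nontrivial P] [Algebra.FiniteType K P] (L : Type*) [Field L]
    [Algebra K L] (h : leftFilterDim L (L ⊗[K] opAlgebra K P) ≠ ⊤) :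
    gkDim K (opAlgebra K P) ≠ ⊤ := by
  obtain ⟨s, φ, hφ⟩ := Algebra.FiniteType.iff_quotient_mvPolynomial''.mp
    (inferInstance : Algebra.FiniteType K P)
  obtain ⟨t, ht⟩ := (inferInstance : Algebra.FiniteType K P).out
  let V₀ : Submodule K P := Submodule.span K (t : Set P)
  have hV₀fin : FiniteDimensional K V₀ := FiniteDimensional.span_finset K t
  have hV₀ : Algebra.adjoin K (V₀ : Set P) = ⊤ := by
    simp only [V₀]
    rw [Algebra.adjoin_span, ht]
  obtain ⟨C, hC⟩ := exists_finrank_stdFiltration_le φ (RingHom.Finite.of_surjective _ hφ) V₀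
  obtain ⟨r, hr, -⟩ := ENNReal.lt_iff_exists_nnreal_btwn.mp (lt_top_iff_ne_top.mpr h)
  let ρ : opAlgebra K P →ₐ[K] Module.End K P := (opAlgebra K P).val
  have hv : (1 : L) ⊗ₜ[K] (1 : P) ≠ 0 := by
    rw [← Algebra.TensorProduct.one_def]
    exact one_ne_zero
  -- The orbit of `1` under the `i`-th filtration step of `A(P)` lies in degree `c * i` of `P`. As
  -- `P` is a quotient of a polynomial ring in `s` variables, the filter inequality holds with `t =
  -- s`.
  refine ne_top_of_le_ne_top ENNReal.coe_ne_top
    (gkDim_le_of_representation (t := s) (baseChangeRep L ρ) hv (fun V hV => ?_) hr)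
  have hVfg : V.FG := Module.Finite.iff_fg.mp hV
  obtain ⟨c, hc⟩ := hVfg.exists_le_of_monotone (degreeRaising_mono V₀)
    fun f _ => exists_mem_degreeRaising hV₀ f
  have hone : (1 : Submodule K (opAlgebra K P)) ≤ degreeRaising V₀ c :=
    Submodule.one_le.mpr fun D p hp => stdFiltration_mono V₀ (by lia) hp
  have hVc : ∀ i, stdFiltration K V i ≤ degreeRaising V₀ (c * i) := by
    intro i
    induction i with
    | zero =>
      rw [stdFiltration_zero]
      exact Submodule.one_le.mpr fun D p hp => hp
    | succ i ih =>
      rw [stdFiltration_succ]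
      exact (mul_le_mul' ih (sup_le hone hc)).trans (degreeRaising_mul_le V₀ _ _)
  refine ⟨C * ((c + 1 : ℕ) : ℝ≥0) ^ (s : ℝ), fun i => ?_⟩
  have hle : orbitSpan (baseChangeRep L ρ) ((1 : L) ⊗ₜ[K] (1 : P))
      ((stdFiltration K V i).baseChange L) ≤ (stdFiltration K V₀ (c * i)).baseChange L := by
    rw [orbitSpan_baseChangeRep, Submodule.span_le]
    rintro _ ⟨f, hf, rfl⟩
    refine Submodule.tmul_mem_baseChange_of_mem _ ?_
    have := hVc i hf 0 1 (one_mem_stdFiltration V₀ 0)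
    rwa [zero_add] at this
  have h1 := (Submodule.finrank_mono hle).trans_eq (Submodule.finrank_baseChange L _)
  calc (Module.finrank L (orbitSpan (baseChangeRep L ρ) ((1 : L) ⊗ₜ[K] (1 : P))
        ((stdFiltration K V i).baseChange L)) : ℝ≥0)
      ≤ Module.finrank K (stdFiltration K V₀ (c * i)) := Nat.cast_le.mpr h1
    _ ≤ _ := hC _
    _ ≤ _ := by
      rw [mul_assoc, NNReal.coe_natCast, ← NNReal.mul_rpow]
      gcongr
      have : c * i + 1 ≤ (c + 1) * (i + 1) := by nlinarith
      exact_mod_cast this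

end Poisson

/-! ### Limits, the optimal bound, and isotropic subalgebras. -/

section Final

/-- As `ε` tends to `0` the hypothesis becomes `g ≤ (g - n) (f + max f 1)`, which is then solved for
`n`. -/
lemma le_mul_one_sub_of_forall {n g f : ℝ}
    (hf : 0 ≤ f)
    (h : ∀ ε : ℝ, 0 < ε → g ≤ (g + ε - n) * (f + ε + max (f + ε) 1)) :
    n ≤ g * (1 - 1 / (f + max f 1)) := by
  have hlim : g ≤ (g - n) * (f + max f 1) := by
    have hc : Continuous fun ε : ℝ => (g + ε - n) * (f + ε + max (f + ε) 1) := by fun_prop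
    have ht := (hc.tendsto 0).mono_left (nhdsWithin_le_nhds (s := Set.Ioi 0))
    simp only [add_zero] at ht
    exact ge_of_tendsto ht (eventually_mem_nhdsWithin.mono fun ε hε => h ε hε)
  have hF : 0 < f + max f 1 := by positivity
  rw [mul_sub, mul_one, mul_one_div, le_sub_comm, div_le_iff₀ hF]
  exact hlim

lemma monotone_mul_one_sub (g : ℝ≥0∞) :
    Monotone fun f : ℝ≥0∞ => g * (1 - 1 / (f + max f 1)) := fun f f' h => by
  dsimp only
  gcongr

lemma natCast_le_gkDim {K : Type u} {A : Type v} [Field K] [Ring A] [Algebra K A]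
    [Nontrivial A] {n : ℕ} (φ : MvPolynomial (Fin n) K →ₐ[K] A) (hφ : Function.Injective φ) :
    (n : ℝ≥0∞) ≤ gkDim K A := by
  refine le_of_forall_gt fun b hb => ?_
  obtain ⟨r, hr, hrb⟩ := ENNReal.lt_iff_exists_nnreal_btwn.mp hb
  refine lt_of_le_of_lt ?_ hrb
  exact_mod_cast (bounds_of_polynomialSubalgebra φ hφ hr).1

/-- The inequality for an algebra with a polynomial subalgebra in `n` variables. -/
lemma natCast_le_of_polynomialSubalgebra {K : Type u} {A : Type v} [Field K] [Ring A] [Algebra K A]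
    [Nontrivial A] {n : ℕ} (φ : MvPolynomial (Fin n) K →ₐ[K] A) (hφ : Function.Injective φ)
    {f : ℝ≥0∞} (hf : leftFilterDim (RatFunField K n) (RatFunField K n ⊗[K] A) ≤ f)
    (hfin : f ≠ ⊤ → gkDim K A ≠ ⊤) :
    (n : ℝ≥0∞) ≤ gkDim K A * (1 - 1 / (f + max f 1)) := by
  have hn := natCast_le_gkDim φ hφ
  -- For `f = ∞` the correction term vanishes and only `n ≤ GK(A)` is left.
  rcases eq_or_ne f ⊤ with rfl | hftop
  · simpa using hn
  lift f to ℝ≥0 using hftop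
  obtain ⟨g, hg⟩ : ∃ g : ℝ≥0, (g : ℝ≥0∞) = gkDim K A :=
    ⟨_, ENNReal.coe_toNNReal (hfin ENNReal.coe_ne_top)⟩
  rw [← hg]
  have hF : f + max f 1 ≠ 0 := (lt_of_lt_of_le one_pos ((le_max_right f 1).trans le_add_self)).ne'
  have hF1 : 1 / (f + max f 1) ≤ 1 :=
    div_le_one_of_le₀ ((le_max_right f 1).trans le_add_self) zero_le
  have key : (n : ℝ≥0) ≤ g * (1 - 1 / (f + max f 1)) := by
    rw [← NNReal.coe_le_coe, NNReal.coe_mul, NNReal.coe_sub hF1]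
    push_cast
    refine le_mul_one_sub_of_forall f.2 fun ε hε => ?_
    lift ε to ℝ≥0 using hε.le
    have hε' : 0 < ε := by exact_mod_cast hε
    have hr : gkDim K A < ((g + ε : ℝ≥0) : ℝ≥0∞) := by
      rw [← hg, ENNReal.coe_lt_coe]
      exact lt_add_of_pos_right g hε'
    have hs : leftFilterDim (RatFunField K n) (RatFunField K n ⊗[K] A) <
        ((f + ε : ℝ≥0) : ℝ≥0∞) :=
      hf.trans_lt (ENNReal.coe_lt_coe.mpr (lt_add_of_pos_right f hε'))
    obtain ⟨hnr, hb⟩ := bounds_of_polynomialSubalgebra φ hφ hr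
    have := hb _ hs
    rw [← hg, ENNReal.coe_le_coe, ← NNReal.coe_le_coe, NNReal.coe_mul, NNReal.coe_sub hnr] at this
    push_cast at this
    exact this
  have := ENNReal.coe_le_coe.mpr key
  rw [ENNReal.coe_mul, ENNReal.coe_sub, ENNReal.coe_div hF, ENNReal.coe_add] at this
  simpa using this

/-- Centrality of `A` enters here: it keeps `Q_m ⊗ A` simple, as the comparison of `lfd` with `fd`
requires. -/
lemma maxLeftFilterDim_le_maxFilterDim (K : Type u) (A : Type v) [Field K] [Ring A] [Algebra K A]
    [Algebra.IsCentral K A] [IsSimpleRing A] : maxLeftFilterDim K A ≤ maxFilterDim K A :=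
  iSup₂_mono fun m _ => leftFilterDim_le_filterDim fun N hl hr _ ha ha0 =>
    TensorProduct.one_mem_of_mul_mem (RatFunField K m) N hl hr ha ha0

open PoissonAlgebra in
lemma gkDim_le_of_isIsotropic {K : Type u} {P : Type v} [Field K] [CommRing P] [Algebra K P]
    [PoissonAlgebra K P] (hP : IsStronglySimplePoisson K P) (C : Subalgebra K P)
    (hC : IsIsotropic K C) :
    gkDim K C ≤ gkDim K (opAlgebra K P) / 2 *
      (1 - 1 / (maxLeftFilterDim K (opAlgebra K P) +
        max (maxLeftFilterDim K (opAlgebra K P)) 1)) := by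
  have := hP.finiteType
  have := hP.isDomain
  have := hP.isSimple
  set f := maxLeftFilterDim K (opAlgebra K P)
  have hle : ∀ m : ℕ, (m : ℝ≥0∞) ≤ gkDim K (opAlgebra K P) →
      leftFilterDim (RatFunField K m) (RatFunField K m ⊗[K] opAlgebra K P) ≤ f := fun m hm =>
    le_iSup₂ (f := fun (m : ℕ) (_ : (m : ℝ≥0∞) ≤ gkDim K (opAlgebra K P)) =>
      leftFilterDim (RatFunField K m) (RatFunField K m ⊗[K] opAlgebra K P)) m hm
  -- The term `m = 0` always occurs in the maximum, so finiteness of `f` bounds at least one left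
  -- filter dimension.
  have hfin : f ≠ ⊤ → gkDim K (opAlgebra K P) ≠ ⊤ := fun hf =>
    gkDim_opAlgebra_ne_top (RatFunField K 0) (ne_top_of_le_ne_top hf (hle 0 (by simp)))
  refine gkDim_le_of_forall_polynomialSubalgebra fun s φ hφ => ?_
  have ha : AlgebraicIndependent K fun i => (φ (MvPolynomial.X i) : P) := by
    have h : MvPolynomial.aeval (fun i => (φ (MvPolynomial.X i) : P)) = C.val.comp φ := by
      ext i
      simp
    rw [AlgebraicIndependent, h]
    exact Subtype.val_injective.comp hφ
  obtain ⟨ψ, hψ, -⟩ := hP.independent s _ ha fun i j =>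
    hC _ (φ (MvPolynomial.X i)).2 _ (φ (MvPolynomial.X j)).2
  let θ : MvPolynomial (Fin (s + s)) K →ₐ[K] opAlgebra K P :=
    ψ.comp (MvPolynomial.renameEquiv K finSumFinEquiv.symm).toAlgHom
  have hθ : Function.Injective θ :=
    hψ.comp (MvPolynomial.renameEquiv K finSumFinEquiv.symm).injective
  -- The index `s + s` is admissible in the maximum defining `f`, since the polynomial subalgebra
  -- itself shows `s + s ≤ GK(A(P))`.
  have hss : ((s + s : ℕ) : ℝ≥0∞) ≤ gkDim K (opAlgebra K P) * (1 - 1 / (f + max f 1)) :=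
    natCast_le_of_polynomialSubalgebra θ hθ (hle _ (natCast_le_gkDim θ hθ)) hfin
  rw [ENNReal.div_eq_inv_mul, mul_assoc, ← ENNReal.div_eq_inv_mul,
    ENNReal.le_div_iff_mul_le (by simp) (by simp), mul_two]
  exact_mod_cast hss

theorem mainTheorem11 {K : Type u} {P : Type v} [Field K] [CommRing P] [Algebra K P]
    [PoissonAlgebra K P] (hP : IsStronglySimplePoisson K P)
    (C : Subalgebra K P) (hC : IsIsotropic K C) :
    gkDim K C ≤ gkDim K (PoissonAlgebra.opAlgebra K P) / 2 *
        (1 - 1 / (maxFilterDim K (PoissonAlgebra.opAlgebra K P) +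
          max (maxFilterDim K (PoissonAlgebra.opAlgebra K P)) 1)) ∧
    gkDim K C ≤ gkDim K (PoissonAlgebra.opAlgebra K P) / 2 *
        (1 - 1 / (maxLeftFilterDim K (PoissonAlgebra.opAlgebra K P) +
          max (maxLeftFilterDim K (PoissonAlgebra.opAlgebra K P)) 1)) := by
  have := hP.isCentral
  have := hP.isSimple
  have h := gkDim_le_of_isIsotropic hP C hC
  exact ⟨h.trans (monotone_mul_one_sub _ (maxLeftFilterDim_le_maxFilterDim K _)), h⟩

end Final
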